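/- Let $c,d\ge 1$ be integers, $n=c+d$, $\gcd(n,c)=1$. Let $\mathfrak g=\mathfrak{sl}_n(\mathbb C)$ with trace form $(X,Y)\mapsto\mathrm{tr}(XY)$, Casimir element $\gamma=\sum_\beta g_\beta\otimes g_\beta^*\in\mathfrak g\otimes\mathfrak g$, Cartan subalgebra $\mathfrak h$ of trace zero diagonal matrices, and $a\wedge b=a\otimes b-b\otimes a$. Let $\mathfrak D=\mathfrak g((z^{-1}))\times\mathfrak g$ with the form $\langle (F_1,f_1),(F_2,f_2)\rangle=\mathrm{res}_0\bigl(\mathrm{Tr}(F_1F_2)\tfrac{dz}{z}\bigr)-\mathrm{tr}(f_1f_2)$, i.e. the coefficient of $z^0$ in $\mathrm{Tr}(F_1F_2)$ minus $\mathrm{tr}(f_1f_2)$, and let $\mathfrak P=\{(F(z),F(0)) : F\in\mathfrak g[z]\}$. Write $X\in\mathfrak g$ in blocks $X=\begin{pmatrix}A&B\\ C&D\end{pmatrix}$ with $A$ of size $c\times c$ and $D$ of size $d\times d$, put $X^\sharp=\begin{pmatrix}D&C\\ B&A\end{pmatrix}$, let $\mathfrak b\subset\mathfrak g$ be the subspace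 $B=0$ and $\mathfrak n\subset\mathfrak g$ the subspace $A=B=D=0$, and put $$\mathfrak W_{(c,d)}=\bigl(z^{-2}\mathfrak g[[z^{-1}]]+z^{-1}\mathfrak b+\mathfrak n\bigr)\times\{0\}+\Bigl\{\Bigl(\begin{pmatrix}A&z^{-1}B\\ zC&D\end{pmatrix},X^\sharp\Bigr) : X=\begin{pmatrix}A&B\\ C&D\end{pmatrix}\in\mathfrak g\Bigr\}\subset\mathfrak D.$$ Let $\Phi_+=\{(i,j):1\le i<j\le n\}$, $e_{(i,j)}=e_{ij}$, $-(i,j)=(j,i)$, let $\tau(i,j)=(i+c,j+c)$ (indices modulo $n$), and $p(\alpha)=\min\{k\ge1:\tau^k(\alpha)\notin\Phi_+\}$ for $\alpha\in\Phi_+$. With $u=e_{11}$ and $\tau(e_{ij})=e_{\tau(i,j)}$ let $q_i=\tau^i(u)-\tau^{i-1}(u)$ and $f_i=\frac12(\tau^i(u)+\tau^{i-1}(u))-\frac1nI$ for $1\le i\le n-1$, and let $(q_i^*)$ be the basis of $\mathfrak h$ dual to the basis $(q_i)$ for the trace form. Put $r_c(x,y)=r_{\mathrm{st}}(x,y)+u_c(x,y)+t_c$,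 where $$r_{\mathrm{st}}(x,y)=\frac12\Bigl(\frac{y+x}{y-x}\gamma+\sum_{\alpha\in\Phi_+}e_\alpha\wedge e_{-\alpha}\Bigr),\qquad t_c=\sum_{i=1}^{n-1}q_i^*\otimes f_i,$$ $$u_c(x,y)=\sum_{\alpha\in\Phi_+}\Bigl(\sum_{k=1}^{p(\alpha)-1}e_{\tau^k(\alpha)}\wedge e_{-\alpha}+x\,e_{\tau^{p(\alpha)}(\alpha)}\otimes e_{-\alpha}-y\,e_{-\alpha}\otimes e_{\tau^{p(\alpha)}(\alpha)}\Bigr).$$ Then: 1. $\mathfrak W_{(c,d)}$ is a Lagrangian order transversal to $\mathfrak P$: it is a Lie subalgebra of $\mathfrak D$, it contains $z^{-m}\mathfrak g[[z^{-1}]]\times\{0\}$ for some $m$, the form vanishes on it, and $\mathfrak D=\mathfrak P\oplus\mathfrak W_{(c,d)}$. 2. $r_c$ is the $r$-matrix attached to $\mathfrak W_{(c,d)}$. That is, for every basis $(g_\beta)$ of $\mathfrak g$, with $g_{(k,\beta)}=(z^kg_\beta,(z^kg_\beta)|_{z=0})\in\mathfrak P$ for $k\ge0$, there is exactly one family $(w_{(k,\beta)})$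 in $\mathfrak W_{(c,d)}$ with $\langle g_{(k,\beta)},w_{(k',\beta')}\rangle=\delta_{kk'}\delta_{\beta\beta'}$, and $$\sum_{k\ge0}\sum_\beta x^k g_\beta\otimes\pi(w_{(k,\beta)})(y)=r_c(x,y),$$ as formal series in $x$ with coefficients in $\mathfrak g\otimes\mathfrak g((y^{-1}))$, where $\pi:\mathfrak D\to\mathfrak g((z^{-1}))$ is the projection and $\frac1{y-x}$ is expanded as $\sum_{m\ge0}x^my^{-m-1}$. 3. $r_c$ is a quasi-trigonometric solution of the classical Yang–Baxter equation: $r_c(x,y)-\frac{x}{y-x}\gamma\in(\mathfrak g\otimes\mathfrak g)[x,y]$, and $$[r_c^{12}(x_1,x_2),r_c^{13}(x_1,x_3)]+[r_c^{13}(x_1,x_3),r_c^{23}(x_2,x_3)]+[r_c^{12}(x_1,x_2),r_c^{23}(x_2,x_3)]=0$$ for all pairwise distinct $x_1,x_2,x_3\in\mathbb C$, where $r^{12},r^{13},r^{23}$ are the images of $r$ in $\mathfrak{gl}_n(\mathbb C)^{\otimes3}$. -/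

import Mathlib

set_option maxSynthPendingDepth 3

open scoped TensorProduct

namespace QuasiTrig

noncomputable section

/-- The coefficientwise `ℂ`-algebra structure of the field of formal Laurent series. -/
instance laurentAlgebra : Algebra ℂ (LaurentSeries ℂ) := HahnSeries.instAlgebra

/-! ### The Lie algebra `𝔤 = 𝔰𝔩ₙ`, its trace form and its Casimir element -/

/-- The Lie algebra of trace zero `n × n` matrices over `R`. -/
abbrev SL (n : ℕ) (R : Type) [CommRing R] : Type :=
  ↥(LieAlgebra.SpecialLinear.sl (Fin n) R)

theorem mem_sl {n : ℕ} {R : Type} [CommRing R] {A : Matrix (Fin n) (Fin n) R} :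
    A ∈ LieAlgebra.SpecialLinear.sl (Fin n) R ↔ A.trace = 0 := by
  change A ∈ LinearMap.ker (Matrix.traceLinearMap (Fin n) R R) ↔ _
  simp

theorem trace_val {n : ℕ} {R : Type} [CommRing R] (X : SL n R) : X.1.trace = 0 :=
  mem_sl.1 X.2

/-- The space `𝔤 ⊗ 𝔤` for `𝔤 = 𝔰𝔩ₙ(ℂ)`. -/
abbrev GG (n : ℕ) : Type := SL n ℂ ⊗[ℂ] SL n ℂ

/-- `a ∧ b = a ⊗ b - b ⊗ a`. -/
def wedge {n : ℕ} (a b : SL n ℂ) : GG n := a ⊗ₜ[ℂ] b - b ⊗ₜ[ℂ] a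

/-- The trace form `(X, Y) ↦ tr (X Y)` on `𝔤`. -/
def trForm (n : ℕ) : LinearMap.BilinForm ℂ (SL n ℂ) :=
  LinearMap.mk₂ ℂ (fun X Y => (X.1 * Y.1).trace)
    (fun X X' Y => by simp [add_mul]) (fun a X Y => by simp)
    (fun X Y Y' => by simp [mul_add]) (fun a X Y => by simp)

theorem trForm_apply {n : ℕ} (X Y : SL n ℂ) : trForm n X Y = (X.1 * Y.1).trace := rfl

/-- The conjugate transpose of a trace zero matrix. -/
def adj {n : ℕ} (X : SL n ℂ) : SL n ℂ :=
  ⟨X.1.conjTranspose, mem_sl.2 (by rw [Matrix.trace_conjTranspose, trace_val, star_zero])⟩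

open scoped ComplexOrder in
theorem eq_zero_of_trForm_adj {n : ℕ} {X : SL n ℂ} (h : trForm n X (adj X) = 0) : X = 0 := by
  apply Subtype.ext
  exact Matrix.trace_mul_conjTranspose_self_eq_zero_iff.1 h

theorem trForm_isSymm (n : ℕ) : (trForm n).IsSymm :=
  ⟨fun X Y => Matrix.trace_mul_comm X.1 Y.1⟩

theorem trForm_nondegenerate (n : ℕ) : (trForm n).Nondegenerate :=
  ⟨fun X h => eq_zero_of_trForm_adj (h (adj X)),
    fun X h => eq_zero_of_trForm_adj ((trForm_isSymm n).eq X (adj X) ▸ h (adj X))⟩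

/-- The Casimir element `γ = ∑ᵢ bᵢ ⊗ bᵢ* ∈ 𝔤 ⊗ 𝔤`, where `(bᵢ)` is a basis of `𝔤` and `(bᵢ*)`
the basis dual to it for the trace form. -/
def casimir (n : ℕ) : GG n :=
  ∑ i, Module.finBasis ℂ (SL n ℂ) i ⊗ₜ[ℂ]
    (trForm n).dualBasis (trForm_nondegenerate n) (Module.finBasis ℂ (SL n ℂ)) i

/-! ### Roots and the permutation `τ_c`

The indices `1, …, n` are written `0, …, n - 1`. -/

/-- The cyclic shift `i ↦ i + c` modulo `n`. -/
def shift (n c : ℕ) (i : Fin n) : Fin n := ⟨(i + c) % n, Nat.mod_lt _ i.pos⟩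

theorem shift_injective (n c : ℕ) : Function.Injective (shift n c) := by
  intro i j h
  have h1 : ((i : ℕ) + c) ≡ (j + c) [MOD n] := congrArg Fin.val h
  exact Fin.ext (Nat.ModEq.eq_of_lt_of_lt (Nat.ModEq.add_right_cancel' c h1) i.2 j.2)

/-- The roots of `𝔤`: pairs `(i, j)` with `i ≠ j`. -/
abbrev Root (n : ℕ) : Type := {p : Fin n × Fin n // p.1 ≠ p.2}

/-- The permutation `τ_c : (i, j) ↦ (i + c, j + c)`, on roots. -/
def tau (n c : ℕ) (α : Root n) : Root n :=
  ⟨(shift n c α.1.1, shift n c α.1.2), fun h => α.2 (shift_injective n c h)⟩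

/-- The root `-α`. -/
def neg {n : ℕ} (α : Root n) : Root n := ⟨(α.1.2, α.1.1), fun h => α.2 h.symm⟩

/-- The set `Φ₊` of positive roots. -/
def posRoots (n : ℕ) : Finset (Root n) := Finset.univ.filter fun α => α.1.1 < α.1.2

/-- The root vector `e_α = e_{ij}` for `α = (i, j)`. -/
def rootVec {n : ℕ} (α : Root n) : SL n ℂ :=
  LieAlgebra.SpecialLinear.single α.1.1 α.1.2 α.2 1

/-- `p_c(α) = min {k | τ_c^k(α) ∉ Φ₊}`. -/
def pNum (n c : ℕ) (α : Root n) : ℕ := sInf {k : ℕ | 0 < k ∧ (tau n c)^[k] α ∉ posRoots n}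

/-! ### The Cartan part -/

/-- The Cartan subalgebra `𝔥` of trace zero diagonal matrices. -/
def cartan (n : ℕ) : Submodule ℂ (SL n ℂ) where
  carrier := {X | X.1.IsDiag}
  add_mem' hX hY := hX.add hY
  zero_mem' := Matrix.isDiag_zero
  smul_mem' a _ hX := hX.smul a

/-- The index `i` for which `τ_c^k(e_{11}) = e_{ii}`. -/
def orb {n : ℕ} (hn : 0 < n) (c k : ℕ) : Fin n := (shift n c)^[k] ⟨0, hn⟩

theorem orb_val {n : ℕ} (hn : 0 < n) (c k : ℕ) : (orb hn c k : ℕ) = (k * c) % n := by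
  induction k with
  | zero => simp [orb]
  | succ k ih =>
    have : orb hn c (k + 1) = shift n c (orb hn c k) := Function.iterate_succ_apply' _ _ _
    rw [this]
    simp [shift, ih, Nat.add_mul]

theorem orb_injOn {n c : ℕ} (h : Nat.Coprime n c) (hn : 0 < n) {k l : ℕ} (hk : k < n) (hl : l < n)
    (hkl : orb hn c k = orb hn c l) : k = l := by
  have h1 : k * c ≡ l * c [MOD n] := by
    have := congrArg Fin.val hkl
    rwa [orb_val, orb_val] at this
  exact Nat.ModEq.eq_of_lt_of_lt (Nat.ModEq.cancel_right_of_coprime h h1) hk hl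

/-- The diagonal matrix unit `τ_c^k(u)`, where `u = e_{11}`. -/
def tauU {n : ℕ} (hn : 0 < n) (c k : ℕ) : Matrix (Fin n) (Fin n) ℂ :=
  Matrix.single (orb hn c k) (orb hn c k) 1

theorem tauU_isDiag {n : ℕ} (hn : 0 < n) (c k : ℕ) : (tauU hn c k).IsDiag := by
  intro i j hij
  rw [tauU, Matrix.single_apply, if_neg]
  rintro ⟨rfl, h⟩
  exact hij h

theorem trace_tauU {n : ℕ} (hn : 0 < n) (c k : ℕ) : (tauU hn c k).trace = 1 :=
  Matrix.trace_single_eq_same _ _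

theorem pos_of_fin_pred {n : ℕ} (i : Fin (n - 1)) : 0 < n := by have := i.2; omega

/-- `q_{i+1, c} = τ_c^{i+1}(u) - τ_c^i(u)` for `0 ≤ i < n - 1`. -/
def qVec (n c : ℕ) (i : Fin (n - 1)) : cartan n :=
  ⟨⟨tauU (pos_of_fin_pred i) c (i + 1) - tauU (pos_of_fin_pred i) c i,
    mem_sl.2 (by rw [Matrix.trace_sub, trace_tauU, trace_tauU, sub_self])⟩,
    (tauU_isDiag _ _ _).sub (tauU_isDiag _ _ _)⟩

/-- `f_{i+1, c} = ½ (τ_c^{i+1}(u) + τ_c^i(u)) - (1/n) I` for `0 ≤ i < n - 1`. -/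
def fVec (n c : ℕ) (i : Fin (n - 1)) : cartan n :=
  ⟨⟨(1 / 2 : ℂ) • (tauU (pos_of_fin_pred i) c (i + 1) + tauU (pos_of_fin_pred i) c i)
      - (1 / n : ℂ) • (1 : Matrix (Fin n) (Fin n) ℂ),
    mem_sl.2 (by
      have hn : (n : ℂ) ≠ 0 := Nat.cast_ne_zero.2 (pos_of_fin_pred i).ne'
      rw [Matrix.trace_sub, Matrix.trace_smul, Matrix.trace_smul, Matrix.trace_add, trace_tauU,
        trace_tauU, Matrix.trace_one, Fintype.card_fin, smul_eq_mul, smul_eq_mul,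
        one_div_mul_cancel hn]
      norm_num)⟩,
    (((tauU_isDiag _ _ _).add (tauU_isDiag _ _ _)).smul _).sub
      ((Matrix.isDiag_one).smul _)⟩

/-- The trace form on `𝔥`. -/
def trFormH (n : ℕ) : LinearMap.BilinForm ℂ (cartan n) := (trForm n).restrict (cartan n)

theorem trFormH_nondegenerate (n : ℕ) : (trFormH n).Nondegenerate := by
  have hadj : ∀ X : cartan n, adj X.1 ∈ cartan n := fun X =>
    Matrix.IsDiag.conjTranspose X.2
  exact ⟨fun X h => Subtype.ext (eq_zero_of_trForm_adj (h ⟨adj X.1, hadj X⟩)),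
    fun X h => Subtype.ext (eq_zero_of_trForm_adj
      ((trForm_isSymm n).eq X.1 (adj X.1) ▸ h ⟨adj X.1, hadj X⟩))⟩

/-- Minus the partial sums of the diagonal entries, in the order of the `τ_c`-orbit: these are the
coordinates of a diagonal matrix in `q_{1,c}, …, q_{n-1,c}`. -/
def coords (n c : ℕ) : cartan n →ₗ[ℂ] (Fin (n - 1) → ℂ) where
  toFun X i := -∑ k ∈ Finset.range (i + 1),
    X.1.1 (orb (pos_of_fin_pred i) c k) (orb (pos_of_fin_pred i) c k)
  map_add' X Y := by
    funext i
    simp [Finset.sum_add_distrib]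
    ring
  map_smul' a X := by
    funext i
    simp [Finset.mul_sum]

theorem coords_injective {n c : ℕ} (h : Nat.Coprime n c) : Function.Injective (coords n c) := by
  rw [injective_iff_map_eq_zero]
  intro X hX
  rcases Nat.eq_zero_or_pos n with rfl | hn
  · exact Subtype.ext (Subtype.ext (Matrix.ext fun i => i.elim0))
  have hS : ∀ m, m < n →
      ∑ k ∈ Finset.range m, X.1.1 (orb hn c k) (orb hn c k) = 0 := by
    intro m hm
    rcases m with _ | m
    · simp
    · have := congrFun hX ⟨m, by omega⟩
      exact neg_eq_zero.1 this
  have hbij : Function.Bijective (fun k : Fin n => orb hn c k) :=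
    Finite.injective_iff_bijective.1 fun k l hkl => Fin.ext (orb_injOn h hn k.2 l.2 hkl)
  have htot : ∑ k ∈ Finset.range n, X.1.1 (orb hn c k) (orb hn c k) = 0 := by
    rw [Finset.sum_range, hbij.sum_comp (fun i => X.1.1 i i)]
    exact trace_val X.1
  have hd : ∀ k, k < n → X.1.1 (orb hn c k) (orb hn c k) = 0 := by
    intro k hk
    have h1 := hS k hk
    have h2 : ∑ l ∈ Finset.range (k + 1), X.1.1 (orb hn c l) (orb hn c l) = 0 := by
      rcases Nat.lt_or_ge (k + 1) n with h3 | h3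
      · exact hS _ h3
      · have : k + 1 = n := by omega
        rw [this]; exact htot
    rwa [Finset.sum_range_succ, h1, zero_add] at h2
  refine Subtype.ext (Subtype.ext (Matrix.ext fun i j => ?_))
  by_cases hij : i = j
  · subst hij
    obtain ⟨k, rfl⟩ := hbij.2 i
    exact hd k k.2
  · exact X.2 hij

theorem coords_qVec {n c : ℕ} (h : Nat.Coprime n c) (j : Fin (n - 1)) :
    coords n c (qVec n c j) = Pi.single j 1 := by
  funext i
  have hn := pos_of_fin_pred i
  have hi := i.2
  have hj := j.2
  have key : ∀ m k, m < n → k < n →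
      tauU hn c m (orb hn c k) (orb hn c k) = if k = m then 1 else 0 := by
    intro m k hm hk
    rw [tauU, Matrix.single_apply]
    by_cases hkm : k = m
    · simp [hkm]
    · rw [if_neg hkm, if_neg]
      rintro ⟨h1, -⟩
      exact hkm (orb_injOn h hn hm hk h1).symm
  have hsum : ∀ m, m < n → ∑ k ∈ Finset.range ((i : ℕ) + 1),
      tauU hn c m (orb hn c k) (orb hn c k) = if m < (i : ℕ) + 1 then 1 else 0 := by
    intro m hm
    rw [Finset.sum_congr rfl fun k hk => key m k hm
      (by have := Finset.mem_range.1 hk; omega)]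
    simp
  change -∑ k ∈ Finset.range ((i : ℕ) + 1), (tauU hn c (j + 1) - tauU hn c j)
    (orb hn c k) (orb hn c k) = _
  simp only [Matrix.sub_apply, Finset.sum_sub_distrib]
  rw [hsum _ (by omega), hsum _ (by omega), Pi.single_apply]
  rcases lt_trichotomy (i : ℕ) j with h1 | h1 | h1
  · have : i ≠ j := fun e => by simp [e] at h1
    rw [if_neg (by omega), if_neg (by omega), if_neg this]; simp
  · have : i = j := Fin.ext h1
    rw [if_neg (by omega), if_pos (by omega), if_pos this]; simp
  · have : i ≠ j := fun e => by simp [e] at h1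
    rw [if_pos (by omega), if_pos (by omega), if_neg this]; simp

/-- `(q_{1,c}, …, q_{n-1,c})` as a basis of `𝔥`. -/
def qBasis {n c : ℕ} (h : Nat.Coprime n c) : Module.Basis (Fin (n - 1)) ℂ (cartan n) :=
  Module.Basis.mk (v := qVec n c)
    (LinearIndependent.of_comp (coords n c) (by
      have : (coords n c) ∘ (qVec n c) = fun j => Pi.single j (1 : ℂ) :=
        funext (coords_qVec h)
      rw [this]
      exact Pi.linearIndependent_single_one (Fin (n - 1)) ℂ))
    (by
      intro X _
      have : X = ∑ i, coords n c X i • qVec n c i := by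
        apply coords_injective h
        rw [map_sum]
        simp only [map_smul, coords_qVec h]
        funext j
        simp [Finset.sum_apply, Pi.single_apply]
      rw [this]
      exact Submodule.sum_mem _ fun i _ =>
        Submodule.smul_mem _ _ (Submodule.subset_span ⟨i, rfl⟩))

/-- The basis `(q*_{1,c}, …, q*_{n-1,c})` of `𝔥` dual to `(q_{1,c}, …, q_{n-1,c})` for the
trace form. -/
def qStar {n c : ℕ} (h : Nat.Coprime n c) : Module.Basis (Fin (n - 1)) ℂ (cartan n) :=
  (trFormH n).dualBasis (trFormH_nondegenerate n) (qBasis h)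

/-! ### The explicit formula

The formula is written for `x`, `y` in any commutative `ℂ`-algebra `R` and gives an element of
`R ⊗ (𝔤 ⊗ 𝔤)`.  It is used for `R = ℂ`, where it gives a function of two complex variables, and for
`R = ℂ((y⁻¹))[[x]]`, where it gives the expansion of this function in the domain `|x| < |y|`. -/

/-- `r_st = ½ ( (y + x)/(y - x) γ + ∑_{α ∈ Φ₊} e_α ∧ e_{-α} )`. -/
def rSt (n : ℕ) {R : Type} [CommRing R] [Algebra ℂ R] (x y : R) : R ⊗[ℂ] GG n :=
  (1 / 2 : ℂ) • (((y + x) * Ring.inverse (y - x)) ⊗ₜ[ℂ] casimir n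
    + 1 ⊗ₜ[ℂ] ∑ α ∈ posRoots n, wedge (rootVec α) (rootVec (neg α)))

/-- `u_c = ∑_{α ∈ Φ₊} ( ∑_{1 ≤ k < p_c(α)} e_{τ^k(α)} ∧ e_{-α}
  + x e_{τ^{p(α)}(α)} ⊗ e_{-α} - y e_{-α} ⊗ e_{τ^{p(α)}(α)} )`. -/
def uPart (n c : ℕ) {R : Type} [CommRing R] [Algebra ℂ R] (x y : R) : R ⊗[ℂ] GG n :=
  ∑ α ∈ posRoots n,
    ((∑ k ∈ Finset.Ico 1 (pNum n c α),
        1 ⊗ₜ[ℂ] wedge (rootVec ((tau n c)^[k] α)) (rootVec (neg α)))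
      + x ⊗ₜ[ℂ] (rootVec ((tau n c)^[pNum n c α] α) ⊗ₜ[ℂ] rootVec (neg α))
      - y ⊗ₜ[ℂ] (rootVec (neg α) ⊗ₜ[ℂ] rootVec ((tau n c)^[pNum n c α] α)))

/-- `t_c = ∑_{i=1}^{n-1} q*_{i,c} ⊗ f_{i,c}`. -/
def tPart {n c : ℕ} (h : Nat.Coprime n c) : GG n :=
  ∑ i : Fin (n - 1), (qStar h i : SL n ℂ) ⊗ₜ[ℂ] (fVec n c i : SL n ℂ)

/-- `r_c = r_st + u_c + t_c`. -/
def rC {n c : ℕ} (h : Nat.Coprime n c) {R : Type} [CommRing R] [Algebra ℂ R] (x y : R) :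
    R ⊗[ℂ] GG n :=
  rSt n x y + uPart n c x y + 1 ⊗ₜ[ℂ] tPart h

/-- `r_c` as a function of two complex variables (off the diagonal) with values in `𝔤 ⊗ 𝔤`. -/
def rCFun {n c : ℕ} (h : Nat.Coprime n c) (x y : ℂ) : GG n :=
  TensorProduct.lid ℂ (GG n) (rC h x y)

/-! ### The classical Yang-Baxter equation and quasi-trigonometric solutions -/

/-- The associative algebra `𝔞 = 𝔤𝔩ₙ(ℂ)`. -/
abbrev Mat (n : ℕ) : Type := Matrix (Fin n) (Fin n) ℂ

/-- The inclusion `𝔤 → 𝔞`. -/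
def slVal (n : ℕ) : SL n ℂ →ₗ[ℂ] Mat n where
  toFun X := X.1
  map_add' _ _ := rfl
  map_smul' _ _ := rfl

/-- The inclusion `𝔤 ⊗ 𝔤 → 𝔞 ⊗ 𝔞`. -/
def incl (n : ℕ) : GG n →ₗ[ℂ] Mat n ⊗[ℂ] Mat n := TensorProduct.map (slVal n) (slVal n)

/-- `a ⊗ b ↦ a ⊗ b ⊗ 1`. -/
def i12 (n : ℕ) : GG n →ₗ[ℂ] Mat n ⊗[ℂ] (Mat n ⊗[ℂ] Mat n) :=
  (TensorProduct.map LinearMap.id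
    (Algebra.TensorProduct.includeLeft : Mat n →ₐ[ℂ] Mat n ⊗[ℂ] Mat n).toLinearMap) ∘ₗ incl n

/-- `a ⊗ b ↦ a ⊗ 1 ⊗ b`. -/
def i13 (n : ℕ) : GG n →ₗ[ℂ] Mat n ⊗[ℂ] (Mat n ⊗[ℂ] Mat n) :=
  (TensorProduct.map LinearMap.id
    (Algebra.TensorProduct.includeRight : Mat n →ₐ[ℂ] Mat n ⊗[ℂ] Mat n).toLinearMap) ∘ₗ incl n

/-- `a ⊗ b ↦ 1 ⊗ a ⊗ b`. -/
def i23 (n : ℕ) : GG n →ₗ[ℂ] Mat n ⊗[ℂ] (Mat n ⊗[ℂ] Mat n) :=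
  (Algebra.TensorProduct.includeRight :
    (Mat n ⊗[ℂ] Mat n) →ₐ[ℂ] Mat n ⊗[ℂ] (Mat n ⊗[ℂ] Mat n)).toLinearMap ∘ₗ incl n

/-- The classical Yang-Baxter equation for a function with values in `𝔤 ⊗ 𝔤`, defined off the
diagonal. -/
def IsCYBESolution {n : ℕ} (r : ℂ → ℂ → GG n) : Prop :=
  ∀ x₁ x₂ x₃ : ℂ, x₁ ≠ x₂ → x₁ ≠ x₃ → x₂ ≠ x₃ →
    ⁅i12 n (r x₁ x₂), i13 n (r x₁ x₃)⁆ + ⁅i13 n (r x₁ x₃), i23 n (r x₂ x₃)⁆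
      + ⁅i12 n (r x₁ x₂), i23 n (r x₂ x₃)⁆ = 0

/-- Evaluation at `(x, y)` of a polynomial in two variables with coefficients in `𝔤 ⊗ 𝔤`. -/
def evalPoly {n : ℕ} (x y : ℂ) (p : MvPolynomial (Fin 2) ℂ ⊗[ℂ] GG n) : GG n :=
  TensorProduct.lid ℂ (GG n)
    (LinearMap.rTensor (GG n) (MvPolynomial.aeval (R := ℂ) ![x, y]).toLinearMap p)

/-- `r` is a quasi-trigonometric solution of the classical Yang-Baxter equation:
`r(x, y) = x/(y - x) γ + p(x, y)` with `p ∈ (𝔤 ⊗ 𝔤)[x, y]`. -/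
def IsQuasiTrigonometricSolution {n : ℕ} (r : ℂ → ℂ → GG n) : Prop :=
  (∃ p : MvPolynomial (Fin 2) ℂ ⊗[ℂ] GG n, ∀ x y : ℂ, x ≠ y →
    r x y = (x / (y - x)) • casimir n + evalPoly x y p) ∧ IsCYBESolution r

/-! ### The Lie algebra `𝔇 = 𝔤((z⁻¹)) × 𝔤` and Lagrangian orders

`ℂ((z⁻¹))` is the field of formal Laurent series in the variable `z⁻¹`. -/

/-- The element `z^m` of `ℂ((z⁻¹))`. -/
def zPow (m : ℤ) : LaurentSeries ℂ := HahnSeries.single (-m) 1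

/-- The coefficient of `z^m` in an element of `ℂ((z⁻¹))`. -/
def zCoeff (m : ℤ) : LaurentSeries ℂ →ₗ[ℂ] ℂ where
  toFun f := f.coeff (-m)
  map_add' _ _ := rfl
  map_smul' _ _ := rfl

/-- The map `𝔰𝔩ₙ(R) → 𝔰𝔩ₙ(S)` that applies a `ℂ`-linear map `R → S` to every entry. -/
def entrywise (n : ℕ) {R S : Type} [CommRing R] [CommRing S] [Algebra ℂ R] [Algebra ℂ S]
    (φ : R →ₗ[ℂ] S) : SL n R →ₗ[ℂ] SL n S where
  toFun X := ⟨X.1.map φ, mem_sl.2 (by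
    have h := congrArg φ (trace_val X)
    rw [map_zero, Matrix.trace, map_sum] at h
    exact h)⟩
  map_add' X Y := Subtype.ext (Matrix.ext fun i j => map_add φ (X.1 i j) (Y.1 i j))
  map_smul' a X := Subtype.ext (Matrix.ext fun i j => map_smul φ a (X.1 i j))

/-- `𝔇 = 𝔤((z⁻¹)) × 𝔤`, where `𝔤((z⁻¹)) = 𝔰𝔩ₙ(ℂ((z⁻¹)))`. -/
abbrev DD (n : ℕ) : Type := SL n (LaurentSeries ℂ) × SL n ℂ

/-- The form `⟨(F₁, f₁), (F₂, f₂)⟩ = res₀ (Tr (F₁ F₂) dz/z) - tr (f₁ f₂)`; the residue is the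
coefficient of `z⁰` in `Tr (F₁ F₂)`. -/
def pairing {n : ℕ} (a b : DD n) : ℂ :=
  zCoeff 0 (a.1.1 * b.1.1).trace - (a.2.1 * b.2.1).trace

/-- The embedding `j : 𝔤[z] → 𝔇`, `F ↦ (F(z), F(0))`. -/
def jMap (n : ℕ) : SL n (Polynomial ℂ) →ₗ[ℂ] DD n :=
  (entrywise n (Polynomial.aeval (R := ℂ) (zPow 1)).toLinearMap).prod
    (entrywise n (Polynomial.aeval (R := ℂ) (0 : ℂ)).toLinearMap)

/-- `𝔓 = j(𝔤[z])`. -/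
def PP (n : ℕ) : Submodule ℂ (DD n) := LinearMap.range (jMap n)

/-- The subspace `z^m 𝔤[[z⁻¹]]` of `𝔤((z⁻¹))`. -/
def tail (n : ℕ) (m : ℤ) : Submodule ℂ (SL n (LaurentSeries ℂ)) where
  carrier := {F | ∀ i j : Fin n, ∀ l : ℤ, m < l → zCoeff l (F.1 i j) = 0}
  add_mem' {F G} hF hG i j l hl := by
    have : zCoeff l (F.1 i j + G.1 i j) = 0 := by rw [map_add, hF i j l hl, hG i j l hl, add_zero]
    exact this
  zero_mem' i j l _ := map_zero (zCoeff l)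
  smul_mem' a F hF i j l hl := by
    have : zCoeff l (a • F.1 i j) = 0 := by rw [map_smul, hF i j l hl, smul_zero]
    exact this

/-- A Lagrangian order in `𝔇`, transversal to `𝔓`. -/
structure IsLagrangianOrder {n : ℕ} (W : Submodule ℂ (DD n)) : Prop where
  lie_mem : ∀ v ∈ W, ∀ w ∈ W, ⁅v, w⁆ ∈ W
  exists_tail_le : ∃ m : ℕ, (tail n (-(m : ℤ))).prod ⊥ ≤ W
  isotropic : ∀ v ∈ W, ∀ w ∈ W, pairing v w = 0
  isCompl : IsCompl (PP n) W

/-- For a basis `(g_β)` of `𝔤`, the element `g_{(k, β)} = j(g_β z^k)` of `𝔓`. -/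
def gElt {n : ℕ} {ι : Type} (g : Module.Basis ι ℂ (SL n ℂ)) (k : ℕ) (β : ι) : DD n :=
  jMap n (entrywise n (Polynomial.monomial (R := ℂ) k) (g β))

/-- `(w_{(k, β)})` is the family in `W` dual to `(g_{(k, β)})`:
`⟨g_{(k, β)}, w_{(k', β')}⟩ = δ_{k k'} δ_{β β'}`. -/
def IsDualFamily {n : ℕ} (W : Submodule ℂ (DD n)) {ι : Type} (g : Module.Basis ι ℂ (SL n ℂ))
    (w : ℕ → ι → DD n) : Prop :=
  (∀ k β, w k β ∈ W) ∧ (∀ k β, pairing (gElt g k β) (w k β) = 1) ∧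
    ∀ k β k' β', (k, β) ≠ (k', β') → pairing (gElt g k β) (w k' β') = 0

/-- The coefficient in `𝔤 ⊗ 𝔤` of `x^k y^l` in the series
`∑_{(k, β)} x^k g_β ⊗ π(w_{(k, β)})(y)`, where `π : 𝔇 → 𝔤((z⁻¹))` is the projection. -/
def seriesCoeff {n : ℕ} {ι : Type} [Fintype ι] (g : Module.Basis ι ℂ (SL n ℂ))
    (w : ℕ → ι → DD n) (k : ℕ) (l : ℤ) : GG n :=
  ∑ β, g β ⊗ₜ[ℂ] entrywise n (zCoeff l) (w k β).1

/-- The ring `ℂ((y⁻¹))[[x]]`. -/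
abbrev SeriesXY : Type := PowerSeries (LaurentSeries ℂ)

/-- The element `x` of `ℂ((y⁻¹))[[x]]`. -/
def serX : SeriesXY := PowerSeries.X

/-- The element `y` of `ℂ((y⁻¹))[[x]]`. -/
def serY : SeriesXY := PowerSeries.C (zPow 1)

/-- The coefficient of `x^k y^l` in an element of `ℂ((y⁻¹))[[x]]`. -/
def coeffXY (k : ℕ) (l : ℤ) : SeriesXY →ₗ[ℂ] ℂ where
  toFun F := zCoeff l (PowerSeries.coeff k F)
  map_add' F G := by simp
  map_smul' a F := by
    have : PowerSeries.coeff k (a • F) = a • PowerSeries.coeff k F := rfl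
    simp [this]

/-- The coefficient in `𝔤 ⊗ 𝔤` of `x^k y^l` in an element of `ℂ((y⁻¹))[[x]] ⊗ (𝔤 ⊗ 𝔤)`. -/
def coeffXYTensor {n : ℕ} (k : ℕ) (l : ℤ) (r : SeriesXY ⊗[ℂ] GG n) : GG n :=
  TensorProduct.lid ℂ (GG n) (LinearMap.rTensor (GG n) (coeffXY k l) r)

/-! ### The order `𝔚_(c,d)`

Here `c + d = n`, and matrices are divided into blocks `A B | C D` with `A` of size `c × c` and `D`
of size `d × d`. -/

/-- The Lie algebra `𝔟_(c,d)` of the matrices with `B = 0`. -/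
def bSub (n c : ℕ) : Submodule ℂ (SL n ℂ) where
  carrier := {X | ∀ i j : Fin n, (i : ℕ) < c → c ≤ (j : ℕ) → X.1 i j = 0}
  add_mem' {X Y} hX hY i j hi hj := by
    have : X.1 i j + Y.1 i j = 0 := by rw [hX i j hi hj, hY i j hi hj, add_zero]
    exact this
  zero_mem' _ _ _ _ := rfl
  smul_mem' a X hX i j hi hj := by
    have : a • X.1 i j = 0 := by rw [hX i j hi hj, smul_zero]
    exact this

/-- The Lie algebra `𝔫_(c,d)` of the matrices with `A = 0`, `B = 0` and `D = 0`. -/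
def nSub (n c : ℕ) : Submodule ℂ (SL n ℂ) where
  carrier := {X | ∀ i j : Fin n, ¬(c ≤ (i : ℕ) ∧ (j : ℕ) < c) → X.1 i j = 0}
  add_mem' {X Y} hX hY i j hij := by
    have : X.1 i j + Y.1 i j = 0 := by rw [hX i j hij, hY i j hij, add_zero]
    exact this
  zero_mem' _ _ _ := rfl
  smul_mem' a X hX i j hij := by
    have : a • X.1 i j = 0 := by rw [hX i j hij, smul_zero]
    exact this

/-- The map `X ↦ z^m X` from `𝔤` to `𝔤((z⁻¹))`. -/
def zMul (n : ℕ) (m : ℤ) : SL n ℂ →ₗ[ℂ] SL n (LaurentSeries ℂ) :=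
  entrywise n (LinearMap.toSpanSingleton ℂ (LaurentSeries ℂ) (zPow m))

/-- The power of `z` in the position `(i, j)` of the matrix `A z⁻¹B | zC D`. -/
def twistExp (c i j : ℕ) : ℤ :=
  if i < c ∧ c ≤ j then -1 else if c ≤ i ∧ j < c then 1 else 0

/-- The map that sends the matrix `A B | C D` to the matrix `A z⁻¹B | zC D`. -/
def twist (n c : ℕ) : SL n ℂ →ₗ[ℂ] SL n (LaurentSeries ℂ) where
  toFun X := ⟨Matrix.of fun i j => X.1 i j • zPow (twistExp c i j), mem_sl.2 (by
    have h : ∀ i : Fin n, twistExp c i i = 0 := fun i => by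
      simp only [twistExp]
      rw [if_neg (by omega), if_neg (by omega)]
    simp only [Matrix.trace, Matrix.diag, Matrix.of_apply, h]
    rw [← Finset.sum_smul]
    have h2 : ∑ i, X.1 i i = 0 := trace_val X
    rw [h2, zero_smul])⟩
  map_add' X Y := Subtype.ext (Matrix.ext fun i j =>
    add_smul (X.1 i j) (Y.1 i j) (zPow (twistExp c i j)))
  map_smul' a X := Subtype.ext (Matrix.ext fun i j =>
    smul_assoc a (X.1 i j) (zPow (twistExp c i j)))

/-- The map `X ↦ X♯` that sends the matrix `A B | C D` to the matrix `D C | B A`, with `D` now in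
the upper left corner: row `i < d` of `X♯` is row `c + i` of `X`, row `d + i` of `X♯` is row `i` of
`X`, and in the same way for the columns. -/
def sharp (n c : ℕ) : SL n ℂ →ₗ[ℂ] SL n ℂ where
  toFun X := ⟨X.1.submatrix (shift n c) (shift n c), mem_sl.2 (by
    have h := (Finite.injective_iff_bijective.1 (shift_injective n c)).sum_comp
      (fun i => X.1 i i)
    exact h.trans (trace_val X))⟩
  map_add' _ _ := rfl
  map_smul' _ _ := rfl

/-- The order
`𝔚_(c,d) = (z⁻² 𝔤[[z⁻¹]] + z⁻¹ 𝔟_(c,d) + 𝔫_(c,d)) × {0} + {(A z⁻¹B | zC D, X♯)}`,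
where `X = A B | C D` runs through `𝔤`. -/
def WW (n c : ℕ) : Submodule ℂ (DD n) :=
  (tail n (-2) ⊔ (bSub n c).map (zMul n (-1)) ⊔ (nSub n c).map (zMul n 0)).prod ⊥
    ⊔ LinearMap.range ((twist n c).prod (sharp n c))

end

end QuasiTrig

/-!
Conjugation by `η = diag (1, …, 1, z, …, z)`, with `c` entries equal to `1`, turns `𝔤[[z⁻¹]]` into a
subalgebra of `𝔤((z⁻¹))`, and the order is `𝔚_(c,d) = {(η F η⁻¹, F(∞)♯) : F ∈ 𝔤[[z⁻¹]]}`
(`mem_WW`). Evaluation at `∞` and `X ↦ X♯` are homomorphisms that respect the trace form, so the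
order is an isotropic Lie subalgebra (`WW_lie_mem`, `WW_isotropic`).

Contracting the first tensor factor of `r_c(x, y) = x/(y - x) γ + r₀ + x r₁ + y r₁'` with `a ∈ 𝔤`
gives `x/(y - x) a + U a + x V a + y T a` for three linear operators `U`, `V`, `T` on `𝔤`
(`opConst`, `opX`, `opY`). The elements `w₀(a) = (U a + z T a, U a - a)`,
`w₁(a) = (z⁻¹ a + V a, V a)` and `w_k(a) = (z⁻ᵏ a, 0)` for `k ≥ 2` lie in the order (`wElt_mem`).
This is where the permutation `τ` enters: on root vectors the second component of the order is the
first one moved by `τ⁻¹`, and the sums over `τ^k(α)` with `k < p(α)` telescope; they end when `τ`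
leaves the positive roots, because it then reaches a block with an additional power of `z`. On the
Cartan part `U = (1 - ♯)⁻¹`.

Everything else follows formally. Since `⟨z^k X, w_l(a)⟩ = δ_{kl} tr (X a)`, the elements `w_k(a)`
give the dual family, and they show `𝔇 = 𝔓 + 𝔚_(c,d)`. An element of `𝔓 ∩ 𝔚_(c,d)` is orthogonal
to all `w_k(a)`, hence zero (`eq_zero_of_mem_WW`), which also gives uniqueness of the dual family.
Isotropy of the pairs `(w₀(a), w₀(b))` and `(w₀(a), w₁(b))` is skew-symmetry of `r_c`.

With `R_{ij}` the operator given by `r_c(x_i, x_j)`, skew-symmetry brings the Yang-Baxter equation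
into the form `[R₁₃ a, R₂₃ b] = R₁₃ [a, R₂₁ b] + R₂₃ [R₁₂ a, b]` (`lie_opR`). As functions of
`z = x₃`, expanded at infinity, `R₁₃ a` and `R₂₃ b` are the first components of the elements
`∑ x₁^k w_k(a)` and `∑ x₂^k w_k(b)` of the order. By partial fractions both sides have the same
poles at `x₁` and `x₂`, so that the difference is a polynomial in `z`, and with the second
components taken into account it is an element of `𝔓 ∩ 𝔚_(c,d) = 0`.
-/

namespace QuasiTrig

noncomputable section

/-! ### Coefficients of Laurent series in `z⁻¹` -/

theorem zCoeff_zPow (l m : ℤ) : zCoeff l (zPow m) = if l = m then 1 else 0 := by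
  change (HahnSeries.single (-m) (1 : ℂ)).coeff (-l) = _
  rw [HahnSeries.coeff_single]
  simp

theorem zCoeff_smul_zPow (l m : ℤ) (a : ℂ) :
    zCoeff l (a • zPow m) = if l = m then a else 0 := by
  rw [map_smul, zCoeff_zPow]; simp

theorem zPow_add (m k : ℤ) : zPow (m + k) = zPow m * zPow k := by
  simp [zPow, HahnSeries.single_mul_single, add_comm]

theorem zPow_zero : zPow 0 = 1 := by
  simp [zPow]

theorem laurent_ext {f g : LaurentSeries ℂ} (h : ∀ l, zCoeff l f = zCoeff l g) : f = g := by
  ext l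
  simpa [zCoeff] using h (-l)

/-- Multiplication by `z^m` shifts the coefficients. -/
theorem zCoeff_zPow_mul (l m : ℤ) (f : LaurentSeries ℂ) :
    zCoeff l (zPow m * f) = zCoeff (l - m) f := by
  change (HahnSeries.single (-m) (1 : ℂ) * f).coeff (-l) = f.coeff (-(l - m))
  rw [HahnSeries.coeff_single_mul, one_mul]
  congr 1
  ring

/-- If `f` has degree at most `s` and `g` has degree at most `t`, then `f g` has degree at most
`s + t`. -/
theorem zCoeff_mul_of_lt {f g : LaurentSeries ℂ} {s t l : ℤ} (hf : ∀ l, s < l → zCoeff l f = 0)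
    (hg : ∀ l, t < l → zCoeff l g = 0) (hl : s + t < l) : zCoeff l (f * g) = 0 := by
  change (f * g).coeff (-l) = 0
  rw [HahnSeries.coeff_mul]
  refine Finset.sum_eq_zero fun ij hij => ?_
  rw [Finset.mem_antidiagonal] at hij
  obtain ⟨-, -, h⟩ := hij
  rcases lt_or_ge s (-ij.1) with h1 | h1
  · have := hf _ h1
    simp only [zCoeff, LinearMap.coe_mk, AddHom.coe_mk, neg_neg] at this
    rw [this, zero_mul]
  · have := hg (-ij.2) (by omega)
    simp only [zCoeff, LinearMap.coe_mk, AddHom.coe_mk, neg_neg] at this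
    rw [this, mul_zero]

/-- The leading coefficients multiply. -/
theorem zCoeff_add_mul {f g : LaurentSeries ℂ} {s t : ℤ} (hf : ∀ l, s < l → zCoeff l f = 0)
    (hg : ∀ l, t < l → zCoeff l g = 0) : zCoeff (s + t) (f * g) = zCoeff s f * zCoeff t g := by
  -- After its leading term is removed, `f` has degree at most `s - 1`.
  have h1 : f = (f - zCoeff s f • zPow s) + zCoeff s f • zPow s := by ring
  have hf' : ∀ l, s - 1 < l → zCoeff l (f - zCoeff s f • zPow s) = 0 := by
    intro l hl
    rw [map_sub, zCoeff_smul_zPow]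
    rcases eq_or_ne l s with rfl | h
    · simp
    · rw [if_neg h, hf l (by omega), sub_zero]
  conv_lhs => rw [h1, add_mul, map_add, zCoeff_mul_of_lt hf' hg (by omega), smul_mul_assoc,
    map_smul, zCoeff_zPow_mul]
  simp

/-! ### Elements of `𝔇` and the pairing -/

theorem zMul_apply (n : ℕ) (m : ℤ) (X : SL n ℂ) (i j : Fin n) :
    (zMul n m X).1 i j = X.1 i j • zPow m := rfl

theorem twist_apply (n c : ℕ) (X : SL n ℂ) (i j : Fin n) :
    (twist n c X).1 i j = X.1 i j • zPow (twistExp c i j) := rfl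

theorem sharp_apply (n c : ℕ) (X : SL n ℂ) (i j : Fin n) :
    (sharp n c X).1 i j = X.1 (shift n c i) (shift n c j) := rfl

theorem entrywise_apply {n : ℕ} {R S : Type} [CommRing R] [CommRing S] [Algebra ℂ R] [Algebra ℂ S]
    (φ : R →ₗ[ℂ] S) (X : SL n R) (i j : Fin n) : (entrywise n φ X).1 i j = φ (X.1 i j) := rfl

theorem sl_ext {n : ℕ} {R : Type} [CommRing R] {X Y : SL n R} (h : ∀ i j, X.1 i j = Y.1 i j) :
    X = Y := Subtype.ext (Matrix.ext h)

@[simp] theorem sl_add_apply {n : ℕ} {R : Type} [CommRing R] (X Y : SL n R) (i j : Fin n) :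
    (X + Y).1 i j = X.1 i j + Y.1 i j := rfl

@[simp] theorem sl_sub_apply {n : ℕ} {R : Type} [CommRing R] (X Y : SL n R) (i j : Fin n) :
    (X - Y).1 i j = X.1 i j - Y.1 i j := rfl

@[simp] theorem sl_smul_apply {n : ℕ} (a : ℂ) (X : SL n ℂ) (i j : Fin n) :
    (a • X).1 i j = a * X.1 i j := rfl

@[simp] theorem sl_zero_apply {n : ℕ} {R : Type} [CommRing R] (i j : Fin n) :
    (0 : SL n R).1 i j = 0 := rfl

theorem zCoeff_trace_mul {n : ℕ} (F G : SL n (LaurentSeries ℂ)) (m : ℤ) :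
    zCoeff m (F.1 * G.1).trace = ∑ i, ∑ j, zCoeff m (F.1 i j * G.1 j i) := by
  simp [Matrix.trace, Matrix.mul_apply, map_sum]

theorem zCoeff_trace_zMul_mul {n : ℕ} (X : SL n ℂ) (G : SL n (LaurentSeries ℂ)) (m k : ℤ) :
    zCoeff k ((zMul n m X).1 * G.1).trace = trForm n X (entrywise n (zCoeff (k - m)) G) := by
  rw [zCoeff_trace_mul, trForm_apply, Matrix.trace]
  refine Finset.sum_congr rfl fun i _ => ?_
  rw [Matrix.diag, Matrix.mul_apply]
  refine Finset.sum_congr rfl fun j _ => ?_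
  rw [zMul_apply, smul_mul_assoc, map_smul, zCoeff_zPow_mul]
  rfl

theorem pairing_add_left {n : ℕ} (v v' w : DD n) :
    pairing (v + v') w = pairing v w + pairing v' w := by
  simp [pairing, add_mul]; ring

theorem pairing_sub_right {n : ℕ} (v w w' : DD n) :
    pairing v (w - w') = pairing v w - pairing v w' := by
  simp [pairing, mul_sub]; ring

theorem pairing_zMul_left {n : ℕ} (m : ℤ) (X Y : SL n ℂ) (w : DD n) :
    pairing (zMul n m X, Y) w = trForm n X (entrywise n (zCoeff (-m)) w.1) - trForm n Y w.2 := by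
  rw [pairing, zCoeff_trace_zMul_mul, zero_sub]
  rfl

theorem entrywise_zCoeff_zMul {n : ℕ} (l m : ℤ) (X : SL n ℂ) :
    entrywise n (zCoeff l) (zMul n m X) = if l = m then X else 0 := by
  refine sl_ext fun i j => ?_
  rw [entrywise_apply, zMul_apply, zCoeff_smul_zPow]
  split_ifs <;> rfl

/-! ### The order `𝔚_(c,d)` in coordinates -/

theorem twistExp_eq (c i j : ℕ) :
    twistExp c i j = (if c ≤ i then 1 else 0) - (if c ≤ j then 1 else 0) := by
  unfold twistExp
  split_ifs <;> omega

theorem twistExp_self (c i : ℕ) : twistExp c i i = 0 := by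
  rw [twistExp_eq, sub_self]

theorem twistExp_add (c i j k : ℕ) : twistExp c i j + twistExp c j k = twistExp c i k := by
  simp only [twistExp_eq]; ring

/-- The twisted degree condition: `G = η F η⁻¹` with `F ∈ 𝔤[[z⁻¹]]` and
`η = diag (1, …, 1, z, …, z)`. -/
def TwistBounded {n : ℕ} (c : ℕ) (G : Matrix (Fin n) (Fin n) (LaurentSeries ℂ)) : Prop :=
  ∀ i j : Fin n, ∀ l : ℤ, twistExp c i j < l → zCoeff l (G i j) = 0

/-- The value of `F = η⁻¹ G η` at `z = ∞`. -/
def topCoeff {n : ℕ} (c : ℕ) (G : Matrix (Fin n) (Fin n) (LaurentSeries ℂ)) : Mat n :=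
  Matrix.of fun i j => zCoeff (twistExp c i j) (G i j)

theorem TwistBounded.mul {n c : ℕ} {G H : Matrix (Fin n) (Fin n) (LaurentSeries ℂ)}
    (hG : TwistBounded c G) (hH : TwistBounded c H) : TwistBounded c (G * H) := by
  intro i j l hl
  rw [Matrix.mul_apply, map_sum]
  refine Finset.sum_eq_zero fun k _ => zCoeff_mul_of_lt (hG i k) (hH k j) ?_
  rwa [twistExp_add]

theorem TwistBounded.sub {n c : ℕ} {G H : Matrix (Fin n) (Fin n) (LaurentSeries ℂ)}
    (hG : TwistBounded c G) (hH : TwistBounded c H) : TwistBounded c (G - H) := by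
  intro i j l hl
  rw [Matrix.sub_apply, map_sub, hG i j l hl, hH i j l hl, sub_zero]

theorem topCoeff_mul {n c : ℕ} {G H : Matrix (Fin n) (Fin n) (LaurentSeries ℂ)}
    (hG : TwistBounded c G) (hH : TwistBounded c H) :
    topCoeff c (G * H) = topCoeff c G * topCoeff c H := by
  ext i j
  rw [topCoeff, Matrix.of_apply, Matrix.mul_apply, Matrix.mul_apply, map_sum]
  refine Finset.sum_congr rfl fun k _ => ?_
  rw [← twistExp_add c i k j, zCoeff_add_mul (hG i k) (hH k j)]
  rfl

theorem topCoeff_sub {n : ℕ} (c : ℕ) (G H : Matrix (Fin n) (Fin n) (LaurentSeries ℂ)) :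
    topCoeff c (G - H) = topCoeff c G - topCoeff c H := by
  ext i j
  exact map_sub (zCoeff _) (G i j) (H i j)

/-- `𝔚_(c,d)` consists of the pairs `(η F η⁻¹, F(∞)♯)` with `F ∈ 𝔤[[z⁻¹]]`. -/
theorem mem_WW {n c : ℕ} {v : DD n} :
    v ∈ WW n c ↔ TwistBounded c v.1.1 ∧
      v.2.1 = (topCoeff c v.1.1).submatrix (shift n c) (shift n c) := by
  constructor
  · intro hv
    obtain ⟨a, ha, b, ⟨X, rfl⟩, rfl⟩ := Submodule.mem_sup.1 hv
    obtain ⟨ha1, ha2⟩ := Submodule.mem_prod.1 ha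
    obtain ⟨f, hf, e, he, hfe⟩ := Submodule.mem_sup.1 ha1
    obtain ⟨g, hg, h, hh, rfl⟩ := Submodule.mem_sup.1 hf
    obtain ⟨Y, hY, rfl⟩ := Submodule.mem_map.1 hh
    obtain ⟨Z, hZ, rfl⟩ := Submodule.mem_map.1 he
    have key : ∀ i j : Fin n, ∀ l, twistExp c i j ≤ l → zCoeff l (a.1.1 i j) = 0 := by
      intro i j l hl
      rw [← hfe, sl_add_apply, sl_add_apply, map_add, map_add, zMul_apply, zMul_apply,
        zCoeff_smul_zPow, zCoeff_smul_zPow]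
      have hs := twistExp_eq c i j
      have h1 : zCoeff l (g.1 i j) = 0 := hg i j l (by split_ifs at hs <;> omega)
      have h2 : (if l = -1 then Y.1 i j else 0) = 0 := by
        split_ifs with h
        · exact hY i j (by split_ifs at hs <;> omega) (by split_ifs at hs <;> omega)
        · rfl
      have h3 : (if l = 0 then Z.1 i j else 0) = 0 := by
        split_ifs with h
        · exact hZ i j (by split_ifs at hs <;> omega)
        · rfl
      rw [h1, h2, h3, add_zero, add_zero]
    have ha2' : a.2 = 0 := ha2
    constructor
    · intro i j l hl
      change zCoeff l (a.1.1 i j + (twist n c X).1 i j) = 0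
      rw [map_add, key i j l hl.le, twist_apply, zCoeff_smul_zPow, if_neg hl.ne', add_zero]
    · ext i j
      change a.2.1 i j + X.1 (shift n c i) (shift n c j) =
        zCoeff _ (a.1.1 (shift n c i) (shift n c j) + (twist n c X).1 (shift n c i) (shift n c j))
      rw [map_add, key _ _ _ le_rfl, twist_apply, zCoeff_smul_zPow, if_pos rfl, ha2']
      rfl
  · rintro ⟨h1, h2⟩
    -- `v` and the generator given by its leading coefficients differ by `(F, 0)`, where `F` has
    -- degree below the bound in every entry.
    have htr : (topCoeff c v.1.1).trace = 0 := by
      have h := congrArg (zCoeff 0) (trace_val v.1)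
      rw [map_zero, Matrix.trace, map_sum] at h
      rw [← h, Matrix.trace]
      refine Finset.sum_congr rfl fun i _ => ?_
      change zCoeff (twistExp c i i) _ = _
      rw [twistExp_self]
      rfl
    set X : SL n ℂ := ⟨topCoeff c v.1.1, mem_sl.2 htr⟩ with hX
    set F : SL n (LaurentSeries ℂ) := v.1 - twist n c X with hF
    have hFz : ∀ i j : Fin n, ∀ l, twistExp c i j ≤ l → zCoeff l (F.1 i j) = 0 := by
      intro i j l hl
      rw [hF, sl_sub_apply, map_sub, twist_apply, zCoeff_smul_zPow]
      split_ifs with h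
      · subst h; exact sub_self _
      · rw [h1 i j l (by omega), sub_zero]
    have hv : v = (F, 0) + (twist n c X, sharp n c X) := by
      refine Prod.ext (by simp [hF]) ?_
      rw [Prod.snd_add, zero_add]
      exact Subtype.ext h2
    rw [hv]
    refine Submodule.add_mem_sup (Submodule.mem_prod.2 ⟨?_, rfl⟩) ⟨X, rfl⟩
    have hdec : F = (F - zMul n (-1) (entrywise n (zCoeff (-1)) F)
        - zMul n 0 (entrywise n (zCoeff 0) F))
        + zMul n (-1) (entrywise n (zCoeff (-1)) F) + zMul n 0 (entrywise n (zCoeff 0) F) := by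
      abel
    change F ∈ _
    rw [hdec]
    refine Submodule.add_mem_sup (Submodule.add_mem_sup ?_ ⟨_, ?_, rfl⟩) ⟨_, ?_, rfl⟩
    · intro i j l hl
      simp only [sl_sub_apply, map_sub, zMul_apply, zCoeff_smul_zPow, entrywise_apply]
      split_ifs with h3 h4 h4
      · omega
      · subst h3; simp
      · subst h4; simp
      · have hs := twistExp_eq c i j
        rw [hFz i j l (by split_ifs at hs <;> omega)]; simp
    · intro i j hi hj
      have hs := twistExp_eq c i j
      exact hFz i j _ (by split_ifs at hs <;> omega)
    · intro i j hij
      have hs := twistExp_eq c i j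
      exact hFz i j _ (by split_ifs at hs <;> omega)

theorem twist_sharp_mem (n c : ℕ) (X : SL n ℂ) : (twist n c X, sharp n c X) ∈ WW n c :=
  (le_sup_right : _ ≤ WW n c) ⟨X, rfl⟩

theorem WW_lie_mem {n c : ℕ} {v w : DD n} (hv : v ∈ WW n c) (hw : w ∈ WW n c) :
    ⁅v, w⁆ ∈ WW n c := by
  obtain ⟨hv1, hv2⟩ := mem_WW.1 hv
  obtain ⟨hw1, hw2⟩ := mem_WW.1 hw
  have hsub : ∀ A B : Mat n, (A * B).submatrix (shift n c) (shift n c) =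
      A.submatrix (shift n c) (shift n c) * B.submatrix (shift n c) (shift n c) := fun A B =>
    (Matrix.submatrix_mul_equiv A B _
      (Equiv.ofBijective _ (Finite.injective_iff_bijective.1 (shift_injective n c))) _).symm
  refine mem_WW.2 ⟨(hv1.mul hw1).sub (hw1.mul hv1), ?_⟩
  change v.2.1 * w.2.1 - w.2.1 * v.2.1 =
    (topCoeff c (v.1.1 * w.1.1 - w.1.1 * v.1.1)).submatrix (shift n c) (shift n c)
  rw [topCoeff_sub, topCoeff_mul hv1 hw1, topCoeff_mul hw1 hv1, hv2, hw2, ← hsub, ← hsub]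
  rfl

theorem WW_isotropic {n c : ℕ} {v w : DD n} (hv : v ∈ WW n c) (hw : w ∈ WW n c) :
    pairing v w = 0 := by
  obtain ⟨hv1, hv2⟩ := mem_WW.1 hv
  obtain ⟨hw1, hw2⟩ := mem_WW.1 hw
  have hbij := Finite.injective_iff_bijective.1 (shift_injective n c)
  rw [pairing, zCoeff_trace_mul, hv2, hw2, sub_eq_zero, Matrix.trace]
  simp only [Matrix.diag_apply, Matrix.mul_apply, Matrix.submatrix_apply]
  rw [hbij.sum_comp (fun i => ∑ j, topCoeff c v.1.1 i (shift n c j) *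
    topCoeff c w.1.1 (shift n c j) i)]
  refine Finset.sum_congr rfl fun i _ => ?_
  rw [hbij.sum_comp (fun j => topCoeff c v.1.1 i j * topCoeff c w.1.1 j i)]
  refine Finset.sum_congr rfl fun j _ => ?_
  rw [← twistExp_self c i, ← twistExp_add c i j i, zCoeff_add_mul (hv1 i j) (hw1 j i)]
  rfl

theorem tail_prod_le_WW (n c : ℕ) : (tail n (-2)).prod ⊥ ≤ WW n c :=
  le_sup_of_le_left (Submodule.prod_mono (le_sup_left.trans le_sup_left) le_rfl)

/-! ### The permutation `τ` and the positive roots -/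

theorem mem_posRoots {n : ℕ} {α : Root n} : α ∈ posRoots n ↔ α.1.1 < α.1.2 := by
  simp [posRoots]

theorem shift_val {n c : ℕ} (hc : c < n) (i : Fin n) :
    (shift n c i : ℕ) = if (i : ℕ) + c < n then (i : ℕ) + c else i + c - n := by
  change (i + c) % n = _
  have := i.2
  split_ifs with h
  · exact Nat.mod_eq_of_lt h
  · rw [Nat.mod_eq_sub_mod (by omega), Nat.mod_eq_of_lt (by omega)]

theorem tau_iterate_val {n c : ℕ} (k : ℕ) (α : Root n) :
    ((tau n c)^[k] α).1 = ((shift n c)^[k] α.1.1, (shift n c)^[k] α.1.2) := by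
  induction k with
  | zero => rfl
  | succ k ih =>
    rw [Function.iterate_succ_apply', Function.iterate_succ_apply', Function.iterate_succ_apply']
    change (shift n c _, shift n c _) = _
    rw [ih]

/-- Some power of `τ` moves the second index of a root to the first row, where no positive root
ends. -/
theorem exists_tau_iterate_notMem {n c : ℕ} (h : Nat.Coprime n c) (α : Root n) :
    ∃ k, 0 < k ∧ (tau n c)^[k] α ∉ posRoots n := by
  have hn : 0 < n := α.1.1.pos
  have hbij : Function.Bijective (fun k : Fin n => orb hn c k) :=
    Finite.injective_iff_bijective.1 fun k l hkl => Fin.ext (orb_injOn h hn k.2 l.2 hkl)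
  obtain ⟨m, hm⟩ := hbij.2 α.1.2
  refine ⟨n - m, by have := m.2; omega, ?_⟩
  rw [mem_posRoots, tau_iterate_val]
  have h0 : ((shift n c)^[n - m] α.1.2 : ℕ) = 0 := by
    rw [← hm]
    change ((shift n c)^[n - m] ((shift n c)^[m] ⟨0, hn⟩) : ℕ) = 0
    rw [← Function.iterate_add_apply, Nat.sub_add_cancel m.2.le]
    exact (orb_val hn c n).trans (Nat.mul_mod_right n c)
  rw [Fin.lt_def, h0]
  exact Nat.not_lt_zero _

section pNum

variable {n c : ℕ}

theorem pNum_pos (h : Nat.Coprime n c) (α : Root n) : 0 < pNum n c α :=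
  (Nat.sInf_mem (exists_tau_iterate_notMem h α)).1

theorem tau_iterate_pNum_notMem (h : Nat.Coprime n c) (α : Root n) :
    (tau n c)^[pNum n c α] α ∉ posRoots n :=
  (Nat.sInf_mem (exists_tau_iterate_notMem h α)).2

theorem tau_iterate_mem {α : Root n} (hα : α ∈ posRoots n) {k : ℕ} (hk : k < pNum n c α) :
    (tau n c)^[k] α ∈ posRoots n := by
  rcases Nat.eq_zero_or_pos k with rfl | h0
  · exact hα
  · by_contra hcon
    exact Nat.notMem_of_lt_sInf hk ⟨h0, hcon⟩

theorem pNum_eq_one (h : Nat.Coprime n c) {α : Root n} (hα : tau n c α ∉ posRoots n) :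
    pNum n c α = 1 :=
  le_antisymm (Nat.sInf_le ⟨one_pos, hα⟩) (pNum_pos h α)

theorem pNum_eq_succ (h : Nat.Coprime n c) {α : Root n} (hα : tau n c α ∈ posRoots n) :
    pNum n c α = pNum n c (tau n c α) + 1 := by
  have hp := pNum_pos h α
  have hne : pNum n c α ≠ 1 := fun h1 => by
    have := tau_iterate_pNum_notMem h α
    rw [h1] at this
    exact this hα
  refine le_antisymm (Nat.sInf_le ⟨Nat.succ_pos _, ?_⟩) ?_
  · rw [Function.iterate_succ_apply]
    exact tau_iterate_pNum_notMem h _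
  · obtain ⟨m, hm⟩ : ∃ m, pNum n c α = m + 1 := ⟨pNum n c α - 1, by omega⟩
    have h1 := tau_iterate_pNum_notMem h α
    rw [hm, Function.iterate_succ_apply] at h1
    rw [hm]
    exact Nat.succ_le_succ (Nat.sInf_le ⟨by omega, h1⟩)

/-- `τ` keeps a positive root positive exactly when the image lies in a diagonal block; otherwise
the image lies in the lower left block. -/
theorem twistExp_tau (hc : c < n) {α : Root n} (hα : α ∈ posRoots n) :
    twistExp c (tau n c α).1.1 (tau n c α).1.2 = if tau n c α ∈ posRoots n then 0 else 1 := by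
  simp only [mem_posRoots, Fin.lt_def] at hα ⊢
  change twistExp c (shift n c α.1.1) (shift n c α.1.2) =
    if (shift n c α.1.1 : ℕ) < shift n c α.1.2 then 0 else 1
  have h1 := α.1.1.2
  have h2 := α.1.2.2
  rw [twistExp_eq, shift_val hc, shift_val hc]
  split_ifs <;> omega

end pNum

/-! ### Root vectors -/

theorem rootVec_apply {n : ℕ} (α : Root n) (i j : Fin n) :
    (rootVec α).1 i j = if α.1.1 = i ∧ α.1.2 = j then 1 else 0 := by
  rw [rootVec, LieAlgebra.SpecialLinear.val_single, Matrix.single_apply]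

theorem trForm_rootVec_left {n : ℕ} (α : Root n) (X : SL n ℂ) :
    trForm n (rootVec α) X = X.1 α.1.2 α.1.1 := by
  rw [trForm_apply, rootVec, LieAlgebra.SpecialLinear.val_single, Matrix.trace_single_mul, one_smul]

theorem sharp_rootVec_tau {n c : ℕ} (α : Root n) : sharp n c (rootVec (tau n c α)) = rootVec α := by
  refine sl_ext fun i j => ?_
  rw [sharp_apply, rootVec_apply, rootVec_apply]
  simp [tau, (shift_injective n c).eq_iff]

theorem twist_rootVec {n c : ℕ} (α : Root n) :
    twist n c (rootVec α) = zMul n (twistExp c α.1.1 α.1.2) (rootVec α) := by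
  refine sl_ext fun i j => ?_
  rw [twist_apply, zMul_apply, rootVec_apply]
  split_ifs with h
  · rw [h.1, h.2]
  · rw [zero_smul, zero_smul]

theorem sum_smul_rootVec_neg_apply {n : ℕ} (g : Root n → ℂ) (i j : Fin n) :
    (∑ α ∈ posRoots n, g α • rootVec (neg α)).1 i j =
      if h : j < i then g ⟨(j, i), h.ne⟩ else 0 := by
  rw [AddSubmonoidClass.coe_finsetSum, Matrix.sum_apply]
  simp only [sl_smul_apply, rootVec_apply, neg]
  split_ifs with h
  · rw [Finset.sum_eq_single ⟨(j, i), h.ne⟩]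
    · simp
    · rintro ⟨⟨k, l⟩, hb⟩ - hne
      rw [if_neg, mul_zero]
      rintro ⟨rfl, rfl⟩
      exact hne rfl
    · intro hcon
      exact absurd (mem_posRoots.2 h) hcon
  · refine Finset.sum_eq_zero fun α hα => ?_
    rw [if_neg, mul_zero]
    rintro ⟨rfl, rfl⟩
    exact h (mem_posRoots.1 hα)

theorem sum_smul_rootVec_apply {n : ℕ} (g : Root n → ℂ) (i j : Fin n) :
    (∑ α ∈ posRoots n, g α • rootVec α).1 i j =
      if h : i < j then g ⟨(i, j), h.ne⟩ else 0 := by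
  rw [AddSubmonoidClass.coe_finsetSum, Matrix.sum_apply]
  simp only [sl_smul_apply, rootVec_apply]
  split_ifs with h
  · rw [Finset.sum_eq_single ⟨(i, j), h.ne⟩]
    · simp
    · rintro ⟨⟨k, l⟩, hb⟩ - hne
      rw [if_neg, mul_zero]
      rintro ⟨rfl, rfl⟩
      exact hne rfl
    · intro hcon
      exact absurd (mem_posRoots.2 h) hcon
  · refine Finset.sum_eq_zero fun α hα => ?_
    rw [if_neg, mul_zero]
    rintro ⟨rfl, rfl⟩
    exact h (mem_posRoots.1 hα)

/-! ### Elements of `𝔚_(c,d)` built from root vectors and Cartan elements -/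

/-- The run `α, τ(α), …, τ^{p-1}(α)` of positive roots gives an element of the order: the pairs
`(τ^k(e_α), τ^{k-1}(e_α))` add up, the last one with a factor `z`. -/
theorem sum_tau_mem_WW {n c : ℕ} (hc : c < n) (h : Nat.Coprime n c) {α : Root n}
    (hα : α ∈ posRoots n) :
    ((zMul n 0 (∑ k ∈ Finset.Ico 1 (pNum n c α), rootVec ((tau n c)^[k] α))
        + zMul n 1 (rootVec ((tau n c)^[pNum n c α] α)),
      ∑ k ∈ Finset.range (pNum n c α), rootVec ((tau n c)^[k] α)) : DD n) ∈ WW n c := by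
  have hmem : ∑ k ∈ Finset.range (pNum n c α),
      ((twist n c (rootVec ((tau n c)^[k + 1] α)),
        sharp n c (rootVec ((tau n c)^[k + 1] α))) : DD n) ∈ WW n c :=
    Submodule.sum_mem _ fun k _ => twist_sharp_mem _ _ _
  convert hmem using 1
  obtain ⟨m, hm⟩ : ∃ m, pNum n c α = m + 1 := ⟨pNum n c α - 1, by have := pNum_pos h α; omega⟩
  refine Prod.ext ?_ ?_
  · rw [Prod.fst_sum]
    change _ = ∑ k ∈ Finset.range (pNum n c α), twist n c (rootVec ((tau n c)^[k + 1] α))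
    change zMul n 0 (∑ k ∈ Finset.Ico 1 (pNum n c α), rootVec ((tau n c)^[k] α))
      + zMul n 1 (rootVec ((tau n c)^[pNum n c α] α)) = _
    rw [hm, Finset.sum_Ico_eq_sum_range, Finset.sum_range_succ, map_sum]
    congr 1
    · refine Finset.sum_congr rfl fun k hk => ?_
      have hk : k + 1 < pNum n c α := by have := Finset.mem_range.1 hk; omega
      have h1 := tau_iterate_mem hα hk
      rw [twist_rootVec]
      have h2 := tau_iterate_mem hα (show k < pNum n c α by omega)
      have h3 := twistExp_tau hc h2
      rw [← Function.iterate_succ_apply' (tau n c)] at h3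
      rw [h3, if_pos h1, add_comm 1 k]
    · rw [twist_rootVec]
      have h1 := tau_iterate_pNum_notMem h α
      rw [hm] at h1
      have h2 := tau_iterate_mem hα (show m < pNum n c α by omega)
      have h3 := twistExp_tau hc h2
      rw [← Function.iterate_succ_apply' (tau n c)] at h3
      rw [h3, if_neg h1]
  · rw [Prod.snd_sum]
    change ∑ k ∈ Finset.range (pNum n c α), rootVec ((tau n c)^[k] α) =
      ∑ k ∈ Finset.range (pNum n c α), sharp n c (rootVec ((tau n c)^[k + 1] α))
    refine Finset.sum_congr rfl fun k _ => ?_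
    rw [Function.iterate_succ_apply', sharp_rootVec_tau]

/-- Elements of the order whose part of degree `0` is strictly lower triangular, with first
component `z⁻¹ b + ∑ g(α) e_{-α}`. The recursion for `g` says that the coefficients at the negative
roots are transported by `τ`; when `τ` makes a negative root positive, it enters the block where the
order has a factor `z⁻¹`, and `g` is read off from `b`. -/
theorem lower_mem_WW {n c : ℕ} (hc : c < n) (b : SL n ℂ) (g g' : Root n → ℂ)
    (hg : ∀ α ∈ posRoots n, g α = g' α +
      if tau n c α ∈ posRoots n then g (tau n c α) else b.1 (tau n c α).1.2 (tau n c α).1.1) :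
    ((zMul n (-1) b + zMul n 0 (∑ α ∈ posRoots n, g α • rootVec (neg α)),
      ∑ α ∈ posRoots n, g α • rootVec (neg α) - ∑ α ∈ posRoots n, g' α • rootVec (neg α)) : DD n)
      ∈ WW n c := by
  have hz : ∀ (i j : Fin n) (l : ℤ),
      zCoeff l ((zMul n (-1) b + zMul n 0 (∑ α ∈ posRoots n, g α • rootVec (neg α))).1 i j) =
        (if l = -1 then b.1 i j else 0) +
          if l = 0 then (if h : j < i then g ⟨(j, i), h.ne⟩ else 0) else 0 := by
    intro i j l
    rw [sl_add_apply, map_add, zMul_apply, zMul_apply, zCoeff_smul_zPow, zCoeff_smul_zPow,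
      sum_smul_rootVec_neg_apply]
  refine mem_WW.2 ⟨fun i j l hl => ?_, ?_⟩
  · change zCoeff l ((zMul n (-1) b + zMul n 0 _).1 i j) = 0
    rw [hz]
    have hs := twistExp_eq c i j
    rw [if_neg (by split_ifs at hs <;> omega), zero_add]
    split_ifs with h1 h2
    · rw [Fin.lt_def] at h2
      split_ifs at hs <;> omega
    · rfl
    · rfl
  · ext i j
    rw [Matrix.submatrix_apply]
    change _ = zCoeff _ ((zMul n (-1) b + zMul n 0 _).1 (shift n c i) (shift n c j))
    rw [hz, sl_sub_apply, sum_smul_rootVec_neg_apply, sum_smul_rootVec_neg_apply]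
    have hi := i.2
    have hj := j.2
    have hs := twistExp_eq c (shift n c i) (shift n c j)
    have h1 := shift_val hc i
    have h2 := shift_val hc j
    by_cases hij : j < i
    · have hgα := hg ⟨(j, i), hij.ne⟩ (mem_posRoots.2 hij)
      rw [dif_pos hij, dif_pos hij, hgα, add_sub_cancel_left]
      simp only [mem_posRoots]
      change (if shift n c j < shift n c i then g ⟨(shift n c j, shift n c i), _⟩
        else b.1 (shift n c i) (shift n c j)) = _
      rw [Fin.lt_def] at hij
      by_cases hτ : shift n c j < shift n c i
      · rw [if_pos hτ, dif_pos hτ]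
        rw [Fin.lt_def] at hτ
        have hs0 : twistExp c (shift n c i) (shift n c j) = 0 := by
          split_ifs at hs h1 h2 <;> omega
        rw [hs0]
        simp
      · rw [if_neg hτ]
        rw [Fin.lt_def] at hτ
        have hs0 : twistExp c (shift n c i) (shift n c j) = -1 := by
          split_ifs at hs h1 h2 <;> omega
        rw [hs0]
        simp
    · rw [dif_neg hij, dif_neg hij, sub_zero]
      rw [Fin.lt_def] at hij
      have hs0 : twistExp c (shift n c i) (shift n c j) ≠ -1 := by
        split_ifs at hs h1 h2 <;> omega
      rw [if_neg hs0, zero_add]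
      split_ifs with h3 h4
      · rw [Fin.lt_def] at h4
        split_ifs at hs h1 h2 <;> omega
      · rfl
      · rfl

theorem cartan_twist {n c : ℕ} {X : SL n ℂ} (hX : X ∈ cartan n) : twist n c X = zMul n 0 X := by
  refine sl_ext fun i j => ?_
  rw [twist_apply, zMul_apply]
  rcases eq_or_ne i j with rfl | h
  · rw [twistExp_self]
  · rw [hX h, zero_smul, zero_smul]

/-- `½ q_i + f_i = τ^i(u) - (1/n) I` and `f_i - ½ q_i = τ^{i-1}(u) - (1/n) I`. -/
theorem half_q_add_f_mem_WW {n c : ℕ} (i : Fin (n - 1)) :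
    ((zMul n 0 ((1 / 2 : ℂ) • (qVec n c i : SL n ℂ) + fVec n c i),
      (fVec n c i : SL n ℂ) - (1 / 2 : ℂ) • (qVec n c i : SL n ℂ)) : DD n) ∈ WW n c := by
  have hn := pos_of_fin_pred i
  have hmem : (1 / 2 : ℂ) • (qVec n c i : SL n ℂ) + fVec n c i ∈ cartan n :=
    Submodule.add_mem _ (Submodule.smul_mem _ _ (qVec n c i).2) (fVec n c i).2
  convert twist_sharp_mem n c ((1 / 2 : ℂ) • (qVec n c i : SL n ℂ) + fVec n c i) using 2
  · exact (cartan_twist hmem).symm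
  · refine sl_ext fun k l => ?_
    have h1 : tauU hn c (i + 1) (shift n c k) (shift n c l) = tauU hn c i k l := by
      have : orb hn c (i + 1) = shift n c (orb hn c i) := Function.iterate_succ_apply' _ _ _
      rw [tauU, tauU, Matrix.single_apply, Matrix.single_apply, this]
      simp [(shift_injective n c).eq_iff]
    have h2 : (1 : Mat n) (shift n c k) (shift n c l) = (1 : Mat n) k l := by
      simp [Matrix.one_apply, (shift_injective n c).eq_iff]
    have hq : ∀ k l, (qVec n c i : SL n ℂ).1 k l = tauU hn c (i + 1) k l - tauU hn c i k l :=
      fun k l => rfl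
    have hf : ∀ k l, (fVec n c i : SL n ℂ).1 k l =
        (1 / 2 : ℂ) * (tauU hn c (i + 1) k l + tauU hn c i k l) - (1 / n : ℂ) * (1 : Mat n) k l :=
      fun k l => rfl
    rw [sharp_apply, sl_sub_apply, sl_add_apply, sl_smul_apply, sl_smul_apply, hq, hq, hf, hf, h1,
      h2]
    ring

/-! ### Tensors as operators -/

theorem sum_apply_smul_dualBasis {V ι : Type*} [AddCommGroup V] [Module ℂ V] [Fintype ι]
    [DecidableEq ι] {B : LinearMap.BilinForm ℂ V} (hB : B.Nondegenerate) (sym : B.IsSymm)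
    (b : Module.Basis ι ℂ V) (x : V) : ∑ i, B (b i) x • B.dualBasis hB b i = x := by
  conv_rhs => rw [← (B.dualBasis hB b).sum_repr x]
  refine Finset.sum_congr rfl fun i _ => ?_
  rw [LinearMap.BilinForm.dualBasis_repr_apply, sym.eq]

theorem sum_apply_dualBasis_smul {V ι : Type*} [AddCommGroup V] [Module ℂ V] [Fintype ι]
    [DecidableEq ι] {B : LinearMap.BilinForm ℂ V} (hB : B.Nondegenerate) (sym : B.IsSymm)
    (b : Module.Basis ι ℂ V) (x : V) : ∑ i, B (B.dualBasis hB b i) x • b i = x := by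
  have h := sum_apply_smul_dualBasis hB sym (B.dualBasis hB b) x
  rwa [LinearMap.BilinForm.dualBasis_dualBasis hB sym] at h

/-- Contraction of the first tensor factor with a matrix: `X ⊗ Y ↦ tr (X a) Y`. It turns an element
of `𝔤 ⊗ 𝔤` into an operator. The argument is allowed to have nonzero trace, because the
Yang-Baxter equation lives in `𝔤𝔩ₙ ⊗ 𝔤𝔩ₙ ⊗ 𝔤𝔩ₙ`. -/
def contr (n : ℕ) : Mat n →ₗ[ℂ] GG n →ₗ[ℂ] SL n ℂ :=
  LinearMap.flip (TensorProduct.lift (LinearMap.mk₂ ℂ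
    (fun X Y => (Matrix.traceLinearMap (Fin n) ℂ ℂ ∘ₗ LinearMap.mulLeft ℂ X.1).smulRight Y)
    (fun X X' Y => by ext1 a; simp [add_mul, add_smul])
    (fun t X Y => by ext1 a; simp [mul_smul])
    (fun X Y Y' => by ext1 a; simp)
    (fun t X Y => by ext1 a; simp [smul_comm t])))

theorem contr_tmul {n : ℕ} (a : Mat n) (X Y : SL n ℂ) :
    contr n a (X ⊗ₜ[ℂ] Y) = (X.1 * a).trace • Y := by
  simp [contr]

theorem contr_val_tmul {n : ℕ} (a X Y : SL n ℂ) :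
    contr n a.1 (X ⊗ₜ[ℂ] Y) = trForm n X a • Y := contr_tmul _ _ _

theorem contr_casimir {n : ℕ} (a : SL n ℂ) : contr n a.1 (casimir n) = a := by
  rw [casimir, map_sum]
  simp only [contr_val_tmul]
  exact sum_apply_smul_dualBasis (trForm_nondegenerate n) (trForm_isSymm n) _ a

/-- An element of `𝔤 ⊗ 𝔤` is recovered from its contractions with a basis. -/
theorem sum_tmul_contr_dualBasis {n : ℕ} {ι : Type} [Fintype ι] [DecidableEq ι]
    (g : Module.Basis ι ℂ (SL n ℂ)) (r : GG n) :
    ∑ i, g i ⊗ₜ[ℂ] contr n ((trForm n).dualBasis (trForm_nondegenerate n) g i).1 r = r := by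
  induction r using TensorProduct.induction_on with
  | zero => simp
  | add r s hr hs =>
    simp only [map_add, TensorProduct.tmul_add, Finset.sum_add_distrib]
    rw [hr, hs]
  | tmul X Y =>
    simp only [contr_val_tmul, TensorProduct.tmul_smul, TensorProduct.smul_tmul']
    rw [← TensorProduct.sum_tmul]
    congr 1
    simp only [(trForm_isSymm n).eq X]
    have := sum_apply_dualBasis_smul (trForm_nondegenerate n) (trForm_isSymm n) g X
    simpa only [(trForm_isSymm n).eq] using this

/-- The diagonal part of a matrix, in the basis `(q_i)`. -/
def cartanPart {n c : ℕ} (h : Nat.Coprime n c) (a : SL n ℂ) : SL n ℂ :=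
  ∑ i, trForm n (qStar h i) a • (qVec n c i : SL n ℂ)

/-- The root decomposition of `𝔤`. -/
theorem root_decomposition {n c : ℕ} (h : Nat.Coprime n c) (a : SL n ℂ) :
    a = ∑ α ∈ posRoots n, a.1 α.1.1 α.1.2 • rootVec α
      + ∑ α ∈ posRoots n, a.1 α.1.2 α.1.1 • rootVec (neg α) + cartanPart h a := by
  set x : SL n ℂ := a - (∑ α ∈ posRoots n, a.1 α.1.1 α.1.2 • rootVec α
      + ∑ α ∈ posRoots n, a.1 α.1.2 α.1.1 • rootVec (neg α)) with hx
  have hxa : ∀ i j, x.1 i j = if i = j then a.1 i j else 0 := by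
    intro i j
    rw [hx, sl_sub_apply, sl_add_apply, sum_smul_rootVec_apply,
      sum_smul_rootVec_neg_apply (fun α => a.1 α.1.2 α.1.1)]
    rcases lt_trichotomy i j with h1 | h1 | h1
    · rw [dif_pos h1, dif_neg h1.not_gt, if_neg h1.ne]; simp
    · subst h1; simp
    · rw [dif_neg h1.not_gt, dif_pos h1, if_neg h1.ne']; simp
  have hxc : x ∈ cartan n := fun i j hij => (hxa i j).trans (if_neg hij)
  have hq : ∀ i, trForm n (qStar h i) a = trFormH n (qStar h i) ⟨x, hxc⟩ := by
    intro i
    change ((qStar h i).1.1 * a.1).trace = ((qStar h i).1.1 * x.1).trace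
    have hd : ∀ k l, k ≠ l → (qStar h i).1.1 k l = 0 := fun k l hkl => (qStar h i).2 hkl
    rw [Matrix.trace, Matrix.trace]
    refine Finset.sum_congr rfl fun k _ => ?_
    rw [Matrix.diag, Matrix.diag, Matrix.mul_apply, Matrix.mul_apply]
    refine Finset.sum_congr rfl fun l _ => ?_
    rcases eq_or_ne k l with rfl | hkl
    · rw [hxa, if_pos rfl]
    · rw [hd k l hkl, zero_mul, zero_mul]
  have hsum := sum_apply_dualBasis_smul (trFormH_nondegenerate n)
    ⟨fun X Y => (trForm_isSymm n).eq X.1 Y.1⟩ (qBasis h) ⟨x, hxc⟩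
  have hcp : cartanPart h a = x := by
    have := congrArg (Subtype.val) hsum
    rw [AddSubmonoidClass.coe_finsetSum] at this
    refine Eq.trans (Finset.sum_congr rfl fun i _ => ?_) this
    rw [hq, qBasis, Submodule.coe_smul]
    congr 2
    exact (Module.Basis.mk_apply _ _ _).symm
  rw [hcp, hx]
  abel

/-! ### The coefficients of the `r`-matrix -/

/-- The constant term of `r_c(x, y) - x/(y - x) γ`. -/
def rConst {n c : ℕ} (h : Nat.Coprime n c) : GG n :=
  (1 / 2 : ℂ) • (casimir n + ∑ α ∈ posRoots n, wedge (rootVec α) (rootVec (neg α)))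
    + ∑ α ∈ posRoots n, ∑ k ∈ Finset.Ico 1 (pNum n c α),
        wedge (rootVec ((tau n c)^[k] α)) (rootVec (neg α))
    + tPart h

/-- The coefficient of `x` in `r_c(x, y) - x/(y - x) γ`. -/
def rCoeffX (n c : ℕ) : GG n :=
  ∑ α ∈ posRoots n, rootVec ((tau n c)^[pNum n c α] α) ⊗ₜ[ℂ] rootVec (neg α)

/-- The coefficient of `y` in `r_c(x, y) - x/(y - x) γ`. -/
def rCoeffY (n c : ℕ) : GG n :=
  -∑ α ∈ posRoots n, rootVec (neg α) ⊗ₜ[ℂ] rootVec ((tau n c)^[pNum n c α] α)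

theorem rC_eq {n c : ℕ} (h : Nat.Coprime n c) {R : Type} [CommRing R] [Algebra ℂ R] {x y : R}
    (hxy : IsUnit (y - x)) :
    rC h x y = (x * Ring.inverse (y - x)) ⊗ₜ[ℂ] casimir n + 1 ⊗ₜ[ℂ] rConst h
      + x ⊗ₜ[ℂ] rCoeffX n c + y ⊗ₜ[ℂ] rCoeffY n c := by
  have h1 : (y + x) * Ring.inverse (y - x) = (2 : ℂ) • (x * Ring.inverse (y - x)) + 1 := by
    have h2 := Ring.mul_inverse_cancel _ hxy
    rw [two_smul]
    linear_combination h2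
  have hu : uPart n c x y = 1 ⊗ₜ[ℂ] (∑ α ∈ posRoots n, ∑ k ∈ Finset.Ico 1 (pNum n c α),
        wedge (rootVec ((tau n c)^[k] α)) (rootVec (neg α)))
      + x ⊗ₜ[ℂ] rCoeffX n c + y ⊗ₜ[ℂ] rCoeffY n c := by
    rw [uPart, rCoeffX, rCoeffY, TensorProduct.tmul_neg, ← sub_eq_add_neg]
    simp only [TensorProduct.tmul_sum, Finset.sum_add_distrib, Finset.sum_sub_distrib]
  rw [rC, hu, rSt, h1, rConst, TensorProduct.add_tmul]
  simp only [TensorProduct.tmul_add, smul_add, TensorProduct.tmul_smul,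
    ← TensorProduct.smul_tmul']
  rw [smul_smul]
  norm_num
  abel

section operators

variable {n c : ℕ} (h : Nat.Coprime n c)

/-- The operator given by the constant term of the `r`-matrix. -/
def opConst (a : SL n ℂ) : SL n ℂ := contr n a.1 (rConst h)

variable (n c) in
/-- The operator given by the coefficient of `x`. -/
def opX (a : SL n ℂ) : SL n ℂ := contr n a.1 (rCoeffX n c)

variable (n c) in
/-- The operator given by the coefficient of `y`. -/
def opY (a : SL n ℂ) : SL n ℂ := contr n a.1 (rCoeffY n c)

theorem trForm_rootVec_neg_left (α : Root n) (X : SL n ℂ) :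
    trForm n (rootVec (neg α)) X = X.1 α.1.1 α.1.2 := trForm_rootVec_left _ _

theorem opX_eq (a : SL n ℂ) : opX n c a = ∑ α ∈ posRoots n,
    a.1 ((tau n c)^[pNum n c α] α).1.2 ((tau n c)^[pNum n c α] α).1.1 • rootVec (neg α) := by
  rw [opX, rCoeffX, map_sum]
  simp only [contr_val_tmul, trForm_rootVec_left]

theorem opY_eq (a : SL n ℂ) : opY n c a = -∑ α ∈ posRoots n,
    a.1 α.1.1 α.1.2 • rootVec ((tau n c)^[pNum n c α] α) := by
  rw [opY, rCoeffY, map_neg, map_sum]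
  simp only [contr_val_tmul, trForm_rootVec_neg_left]

theorem contr_wedge (a : SL n ℂ) (α β : Root n) :
    contr n a.1 (wedge (rootVec α) (rootVec (neg β))) =
      a.1 α.1.2 α.1.1 • rootVec (neg β) - a.1 β.1.1 β.1.2 • rootVec α := by
  rw [wedge, map_sub, contr_val_tmul, contr_val_tmul, trForm_rootVec_left, trForm_rootVec_neg_left]

theorem opConst_eq (a : SL n ℂ) : opConst h a =
    -∑ α ∈ posRoots n, a.1 α.1.1 α.1.2 •
      ∑ k ∈ Finset.Ico 1 (pNum n c α), rootVec ((tau n c)^[k] α)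
    + ∑ α ∈ posRoots n, (∑ k ∈ Finset.range (pNum n c α),
        a.1 ((tau n c)^[k] α).1.2 ((tau n c)^[k] α).1.1) • rootVec (neg α)
    + ∑ i, trForm n (qStar h i) a • ((1 / 2 : ℂ) • (qVec n c i : SL n ℂ) + fVec n c i) := by
  have hdec := root_decomposition h a
  have hr : ∀ α ∈ posRoots n, (∑ k ∈ Finset.range (pNum n c α),
        a.1 ((tau n c)^[k] α).1.2 ((tau n c)^[k] α).1.1) • rootVec (neg α) =
      a.1 α.1.2 α.1.1 • rootVec (neg α) + ∑ k ∈ Finset.Ico 1 (pNum n c α),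
        a.1 ((tau n c)^[k] α).1.2 ((tau n c)^[k] α).1.1 • rootVec (neg α) := by
    intro α _
    rw [Finset.range_eq_Ico, Finset.sum_eq_sum_Ico_succ_bot (pNum_pos h α), add_smul,
      Finset.sum_smul]
    rfl
  rw [opConst, rConst, map_add, map_add, map_smul, map_add, contr_casimir, tPart, map_sum, map_sum,
    map_sum]
  simp only [map_sum, contr_wedge, contr_val_tmul]
  rw [Finset.sum_congr rfl hr]
  simp only [Finset.sum_sub_distrib, Finset.sum_add_distrib, Finset.smul_sum, smul_add, smul_sub]
  have hhalf : (1 / 2 : ℂ) • a = (1 / 2 : ℂ) • (∑ α ∈ posRoots n, a.1 α.1.1 α.1.2 • rootVec α)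
      + (1 / 2 : ℂ) • (∑ α ∈ posRoots n, a.1 α.1.2 α.1.1 • rootVec (neg α))
      + ∑ i, trForm n (qStar h i) a • (1 / 2 : ℂ) • (qVec n c i : SL n ℂ) := by
    conv_lhs => rw [hdec]
    rw [smul_add, smul_add, cartanPart, Finset.smul_sum (s := Finset.univ)]
    simp only [smul_comm (1 / 2 : ℂ)]
  rw [hhalf]
  simp only [← Finset.smul_sum]
  module

end operators

/-! ### The dual family inside `𝔚_(c,d)` -/

section dualFamily

variable {n c : ℕ} (h : Nat.Coprime n c)

/-- The element of `𝔚_(c,d)` that represents the functional `F ↦ tr (F_k a)` on `𝔤[z] ≅ 𝔓`, where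
`F_k` is the coefficient of `z^k`. -/
def wElt : ℕ → SL n ℂ → DD n
  | 0, a => (zMul n 0 (opConst h a) + zMul n 1 (opY n c a), opConst h a - a)
  | 1, a => (zMul n (-1) a + zMul n 0 (opX n c a), opX n c a)
  | k + 2, a => (zMul n (-(k + 2 : ℕ)) a, 0)

theorem wElt_zero_mem (hc : c < n) (a : SL n ℂ) : wElt h 0 a ∈ WW n c := by
  have h1 : ∀ α ∈ posRoots n, a.1 α.1.1 α.1.2 •
      ((zMul n 0 (∑ k ∈ Finset.Ico 1 (pNum n c α), rootVec ((tau n c)^[k] α))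
        + zMul n 1 (rootVec ((tau n c)^[pNum n c α] α)),
      ∑ k ∈ Finset.range (pNum n c α), rootVec ((tau n c)^[k] α)) : DD n) ∈ WW n c :=
    fun α hα => Submodule.smul_mem _ _ (sum_tau_mem_WW hc h hα)
  have h2 := lower_mem_WW hc 0 (fun α => ∑ k ∈ Finset.range (pNum n c α),
        a.1 ((tau n c)^[k] α).1.2 ((tau n c)^[k] α).1.1) (fun α => a.1 α.1.2 α.1.1) (by
    intro α _
    by_cases hτ : tau n c α ∈ posRoots n
    · rw [if_pos hτ, pNum_eq_succ h hτ, Finset.sum_range_succ']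
      simp only [Function.iterate_succ_apply]
      exact add_comm _ _
    · rw [if_neg hτ, pNum_eq_one h hτ]
      simp)
  have h3 : ∀ i, trForm n (qStar h i) a •
      ((zMul n 0 ((1 / 2 : ℂ) • (qVec n c i : SL n ℂ) + fVec n c i),
      (fVec n c i : SL n ℂ) - (1 / 2 : ℂ) • (qVec n c i : SL n ℂ)) : DD n) ∈ WW n c :=
    fun i => Submodule.smul_mem _ _ (half_q_add_f_mem_WW i)
  have hsum := Submodule.add_mem _ (Submodule.add_mem _
    (Submodule.neg_mem _ (Submodule.sum_mem _ h1)) h2)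
    (Submodule.sum_mem (t := Finset.univ) _ fun i _ => h3 i)
  convert hsum using 1
  refine Prod.ext ?_ ?_
  · rw [Prod.fst_add, Prod.fst_add, Prod.fst_neg, Prod.fst_sum, Prod.fst_sum]
    simp only [wElt, Prod.smul_fst]
    rw [opConst_eq, opY_eq, map_zero, zero_add]
    simp only [map_add, map_neg, map_sum, map_smul, smul_add, Finset.sum_add_distrib]
    abel
  · rw [Prod.snd_add, Prod.snd_add, Prod.snd_neg, Prod.snd_sum, Prod.snd_sum]
    simp only [wElt, Prod.smul_snd]
    rw [congrArg (opConst h a - ·) (root_decomposition h a), opConst_eq, cartanPart]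
    have hr : ∀ α ∈ posRoots n, a.1 α.1.1 α.1.2 •
        ∑ k ∈ Finset.range (pNum n c α), rootVec ((tau n c)^[k] α) =
        a.1 α.1.1 α.1.2 • rootVec α + a.1 α.1.1 α.1.2 •
          ∑ k ∈ Finset.Ico 1 (pNum n c α), rootVec ((tau n c)^[k] α) := by
      intro α _
      rw [Finset.range_eq_Ico, Finset.sum_eq_sum_Ico_succ_bot (pNum_pos h α), smul_add]
      rfl
    rw [Finset.sum_congr rfl hr]
    have hq : ∑ i, trForm n (qStar h i) a •
        ((fVec n c i : SL n ℂ) - (1 / 2 : ℂ) • (qVec n c i : SL n ℂ)) =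
        ∑ i, trForm n (qStar h i) a • ((1 / 2 : ℂ) • (qVec n c i : SL n ℂ) + fVec n c i)
        - ∑ i, trForm n (qStar h i) a • (qVec n c i : SL n ℂ) := by
      rw [← Finset.sum_sub_distrib]
      refine Finset.sum_congr rfl fun i _ => ?_
      module
    rw [hq, Finset.sum_add_distrib]
    abel

theorem wElt_one_mem (hc : c < n) (a : SL n ℂ) : wElt h 1 a ∈ WW n c := by
  have h2 := lower_mem_WW hc a (fun α => a.1 ((tau n c)^[pNum n c α] α).1.2
    ((tau n c)^[pNum n c α] α).1.1) (fun _ => 0) (by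
    intro α _
    by_cases hτ : tau n c α ∈ posRoots n
    · rw [if_pos hτ, pNum_eq_succ h hτ, zero_add]
      rfl
    · rw [if_neg hτ, pNum_eq_one h hτ, zero_add]
      rfl)
  simp only [zero_smul, Finset.sum_const_zero, sub_zero] at h2
  rw [← opX_eq] at h2
  exact h2

theorem tail_zMul {m k : ℤ} (hmk : k ≤ m) (a : SL n ℂ) : zMul n k a ∈ tail n m := by
  intro i j l hl
  rw [zMul_apply, zCoeff_smul_zPow, if_neg (by omega)]

theorem wElt_mem (hc : c < n) (k : ℕ) (a : SL n ℂ) : wElt h k a ∈ WW n c := by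
  match k with
  | 0 => exact wElt_zero_mem h hc a
  | 1 => exact wElt_one_mem h hc a
  | k + 2 => exact tail_prod_le_WW n c ⟨tail_zMul (by omega) a, rfl⟩

/-! ### Pairings with the dual family -/

theorem pairing_wElt_zero (a : SL n ℂ) (v : DD n) :
    pairing (wElt h 0 a) v = trForm n (opConst h a) (entrywise n (zCoeff 0) v.1)
      + trForm n (opY n c a) (entrywise n (zCoeff (-1)) v.1)
      - trForm n (opConst h a - a) v.2 := by
  have h1 : wElt h 0 a = ((zMul n 0 (opConst h a), opConst h a - a) : DD n)
      + (zMul n 1 (opY n c a), 0) := by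
    simp [wElt]
  rw [h1, pairing_add_left, pairing_zMul_left, pairing_zMul_left, map_zero, LinearMap.zero_apply,
    neg_zero]
  ring

theorem pairing_wElt_one (a : SL n ℂ) (v : DD n) :
    pairing (wElt h 1 a) v = trForm n a (entrywise n (zCoeff 1) v.1)
      + trForm n (opX n c a) (entrywise n (zCoeff 0) v.1) - trForm n (opX n c a) v.2 := by
  have h1 : wElt h 1 a = ((zMul n (-1) a, 0) : DD n) + (zMul n 0 (opX n c a), opX n c a) := by
    simp [wElt]
  rw [h1, pairing_add_left, pairing_zMul_left, pairing_zMul_left, map_zero, LinearMap.zero_apply,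
    neg_zero, neg_neg]
  ring

theorem eq_zero_of_trForm_left {X : SL n ℂ} (hX : ∀ a, trForm n a X = 0) : X = 0 :=
  (trForm_nondegenerate n).2 X hX

/-- `𝔓 ∩ 𝔚_(c,d) = 0`: an element `v` of the intersection is orthogonal to the order, and pairing
with `w_{(0, β)}` and `w_{(1, β)}` reads off its coefficients. The hypotheses on `v` say that it is
orthogonal to `𝔓`. -/
theorem eq_zero_of_mem_WW (h : Nat.Coprime n c) (hc : c < n) {v : DD n} (hv : v ∈ WW n c)
    (hneg : ∀ l < 0, entrywise n (zCoeff l) v.1 = 0) (h0 : entrywise n (zCoeff 0) v.1 = v.2) :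
    v = 0 := by
  have hv0 : v.2 = 0 := eq_zero_of_trForm_left fun a => by
    have hp := WW_isotropic (wElt_mem h hc 0 a) hv
    rw [pairing_wElt_zero, hneg (-1) (by norm_num), h0, map_zero, map_sub,
      LinearMap.sub_apply] at hp
    linear_combination hp
  have hv1 : entrywise n (zCoeff 1) v.1 = 0 := eq_zero_of_trForm_left fun a => by
    have hp := WW_isotropic (wElt_mem h hc 1 a) hv
    rw [pairing_wElt_one, h0] at hp
    linear_combination hp
  refine Prod.ext (sl_ext fun i j => laurent_ext fun l => ?_) hv0
  rw [Prod.fst_zero, sl_zero_apply, map_zero]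
  rcases lt_trichotomy l 0 with hl | rfl | hl
  · exact congrFun (congrFun (congrArg Subtype.val (hneg l hl)) i) j
  · exact congrFun (congrFun (congrArg Subtype.val (h0.trans hv0)) i) j
  · rcases eq_or_ne l 1 with rfl | h1
    · exact congrFun (congrFun (congrArg Subtype.val hv1) i) j
    · refine (mem_WW.1 hv).1 i j l ?_
      rw [twistExp_eq]
      split_ifs <;> omega

/-- Skew-symmetry of the `r`-matrix, first part: the order is isotropic. -/
theorem trForm_opConst_add (hc : c < n) (a b : SL n ℂ) :
    trForm n (opConst h a) b + trForm n a (opConst h b) = trForm n a b := by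
  have hp := WW_isotropic (wElt_mem h hc 0 a) (wElt_mem h hc 0 b)
  rw [pairing_wElt_zero] at hp
  simp only [wElt, map_add, entrywise_zCoeff_zMul] at hp
  norm_num at hp
  linear_combination hp

/-- Skew-symmetry of the `r`-matrix, second part. -/
theorem trForm_opY_add (h : Nat.Coprime n c) (hc : c < n) (a b : SL n ℂ) :
    trForm n (opY n c a) b + trForm n a (opX n c b) = 0 := by
  have hp := WW_isotropic (wElt_mem h hc 0 a) (wElt_mem h hc 1 b)
  rw [pairing_wElt_zero] at hp
  simp only [wElt, map_add, entrywise_zCoeff_zMul] at hp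
  norm_num at hp
  linear_combination hp

end dualFamily

/-! ### Transversality to `𝔓` -/

theorem zPow_one_pow (k : ℕ) : zPow 1 ^ k = zPow k := by
  induction k with
  | zero => simp [zPow_zero]
  | succ k ih => rw [pow_succ, ih, ← zPow_add]; push_cast; rfl

theorem zCoeff_aeval_zPow (l : ℤ) (p : Polynomial ℂ) :
    zCoeff l (Polynomial.aeval (zPow 1) p) = if 0 ≤ l then p.coeff l.toNat else 0 := by
  induction p using Polynomial.induction_on' with
  | add p q hp hq =>
    rw [map_add, map_add, hp, hq, Polynomial.coeff_add]
    split_ifs <;> simp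
  | monomial k a =>
    rw [Polynomial.aeval_monomial, ← Algebra.smul_def, zPow_one_pow, zCoeff_smul_zPow,
      Polynomial.coeff_monomial]
    split_ifs <;> first | rfl | omega

theorem jMap_monomial {n : ℕ} (k : ℕ) (X : SL n ℂ) :
    jMap n (entrywise n (Polynomial.monomial (R := ℂ) k) X) =
      (zMul n k X, if k = 0 then X else 0) := by
  refine Prod.ext (sl_ext fun i j => ?_) (sl_ext fun i j => ?_)
  · change Polynomial.aeval (zPow 1) (Polynomial.monomial k (X.1 i j)) = X.1 i j • zPow k
    rw [Polynomial.aeval_monomial, ← Algebra.smul_def, zPow_one_pow]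
  · change Polynomial.aeval 0 (Polynomial.monomial k (X.1 i j)) = (ite (k = 0) X 0 : SL n ℂ).1 i j
    rw [Polynomial.aeval_monomial]
    split_ifs with h
    · subst h; simp
    · simp [h]

theorem pairing_jMap_monomial {n : ℕ} (k : ℕ) (X : SL n ℂ) (v : DD n) :
    pairing (jMap n (entrywise n (Polynomial.monomial (R := ℂ) k) X)) v =
      trForm n X (entrywise n (zCoeff (-k)) v.1) - if k = 0 then trForm n X v.2 else 0 := by
  rw [jMap_monomial, pairing_zMul_left]
  split_ifs
  · rfl
  · rw [map_zero, LinearMap.zero_apply]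

theorem exists_forall_zCoeff_eq_zero {n : ℕ} (G : SL n (LaurentSeries ℂ)) :
    ∃ N : ℕ, ∀ i j : Fin n, ∀ l : ℤ, (N : ℤ) ≤ l → zCoeff l (G.1 i j) = 0 := by
  refine ⟨Finset.univ.sup fun p : Fin n × Fin n => (1 - (G.1 p.1 p.2).order).toNat,
    fun i j l hl => ?_⟩
  have h1 := Finset.le_sup (f := fun p : Fin n × Fin n => (1 - (G.1 p.1 p.2).order).toNat)
    (Finset.mem_univ (i, j))
  exact HahnSeries.coeff_eq_zero_of_lt_order (by dsimp only at h1; omega)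

theorem isCompl_PP_WW {n c : ℕ} (hc : c < n) (h : Nat.Coprime n c) :
    IsCompl (PP n) (WW n c) := by
  refine IsCompl.of_eq ?_ ?_
  · rw [eq_bot_iff]
    rintro v ⟨⟨F, rfl⟩, hv⟩
    refine eq_zero_of_mem_WW h hc hv (fun l hl => sl_ext fun i j => ?_) (sl_ext fun i j => ?_)
    · change zCoeff l (Polynomial.aeval (zPow 1) (F.1 i j)) = 0
      rw [zCoeff_aeval_zPow, if_neg (by omega)]
    · change zCoeff 0 (Polynomial.aeval (zPow 1) (F.1 i j)) = Polynomial.aeval 0 (F.1 i j)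
      rw [zCoeff_aeval_zPow, if_pos le_rfl]
      exact Polynomial.coeff_zero_eq_aeval_zero (F.1 i j)
  · have hP : ∀ (k : ℕ) (X : SL n ℂ), ((zMul n k X, if k = 0 then X else 0) : DD n) ∈
        PP n ⊔ WW n c := fun k X =>
      (le_sup_left : PP n ≤ _) ⟨entrywise n (Polynomial.monomial (R := ℂ) k) X, jMap_monomial k X⟩
    have hW : ∀ (k : ℕ) (X : SL n ℂ), wElt h k X ∈ PP n ⊔ WW n c := fun k X =>
      (le_sup_right : WW n c ≤ _) (wElt_mem h hc k X)
    -- Modulo `𝔓`, the element `w₀(X)` equals `(0, -X)`.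
    have h0 : ∀ X : SL n ℂ, ((0, X) : DD n) ∈ PP n ⊔ WW n c := by
      intro X
      have := Submodule.sub_mem _ (Submodule.add_mem _ (hP 0 (opConst h X)) (hP 1 (opY n c X)))
        (hW 0 X)
      convert this using 1
      simp [wElt]
    have hk : ∀ (k : ℕ) (X : SL n ℂ), ((zMul n k X, 0) : DD n) ∈ PP n ⊔ WW n c := by
      intro k X
      convert Submodule.sub_mem _ (hP k X) (h0 (if k = 0 then X else 0)) using 1
      simp
    have hneg : ∀ X : SL n ℂ, ((zMul n (-1) X, 0) : DD n) ∈ PP n ⊔ WW n c := by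
      intro X
      convert Submodule.sub_mem _ (hW 1 X) (hP 0 (opX n c X)) using 1
      simp [wElt]
    -- `G` is split into its polynomial part, its term of degree `-1` and the rest.
    rw [eq_top_iff]
    rintro ⟨G, f⟩ -
    obtain ⟨N, hN⟩ := exists_forall_zCoeff_eq_zero G
    have htail : G - (∑ k ∈ Finset.range N, zMul n k (entrywise n (zCoeff k) G)
        + zMul n (-1) (entrywise n (zCoeff (-1)) G)) ∈ tail n (-2) := by
      intro i j l hl
      have hs : (∑ k ∈ Finset.range N, zMul n k (entrywise n (zCoeff k) G)).1 i j =
          ∑ k ∈ Finset.range N, zCoeff k (G.1 i j) • zPow k := by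
        rw [AddSubmonoidClass.coe_finsetSum, Matrix.sum_apply]
        rfl
      rw [sl_sub_apply, sl_add_apply, hs, map_sub, map_add, map_sum, zMul_apply, zCoeff_smul_zPow]
      simp only [zCoeff_smul_zPow]
      by_cases h1 : l = -1
      · subst h1
        rw [if_pos rfl, Finset.sum_eq_zero fun k _ => if_neg (by omega), zero_add]
        exact sub_self _
      · rw [if_neg h1, add_zero]
        by_cases h2 : (N : ℤ) ≤ l
        · rw [hN i j l h2, zero_sub, neg_eq_zero]
          refine Finset.sum_eq_zero fun k hk => if_neg ?_
          have := Finset.mem_range.1 hk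
          omega
        · rw [Finset.sum_eq_single l.toNat (fun k _ hk => if_neg (by omega)) fun hk =>
            absurd (Finset.mem_range.2 (by omega)) hk, if_pos (by omega),
            Int.toNat_of_nonneg (by omega), sub_self]
    have hT := (le_sup_right : WW n c ≤ PP n ⊔ WW n c) (tail_prod_le_WW n c
      (Submodule.mem_prod.2 ⟨htail, Submodule.zero_mem ⊥⟩ :
        ((_, (0 : SL n ℂ)) : DD n) ∈ (tail n (-2)).prod ⊥))
    have hsum := Submodule.sum_mem _ fun k (_ : k ∈ Finset.range N) =>
      hk k (entrywise n (zCoeff k) G)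
    have := Submodule.add_mem _ (Submodule.add_mem _ hT (Submodule.add_mem _ hsum
      (hneg (entrywise n (zCoeff (-1)) G)))) (h0 f)
    convert this using 1
    refine Prod.ext ?_ ?_
    · simp [Prod.fst_sum]
    · simp [Prod.snd_sum]

theorem isLagrangianOrder_WW {n c : ℕ} (hc : c < n) (h : Nat.Coprime n c) :
    IsLagrangianOrder (WW n c) where
  lie_mem _ hv _ hw := WW_lie_mem hv hw
  exists_tail_le := ⟨2, tail_prod_le_WW n c⟩
  isotropic _ hv _ hw := WW_isotropic hv hw
  isCompl := isCompl_PP_WW hc h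

/-! ### The expansion of `r_c` in the domain `|x| < |y|` -/

section expansion

variable {n c : ℕ} (h : Nat.Coprime n c)

theorem serY_sub_serX_mul :
    (serY - serX) * PowerSeries.mk (fun m => zPow (-((m : ℤ) + 1))) = 1 := by
  refine PowerSeries.ext fun m => ?_
  rw [sub_mul, map_sub, serY, serX, PowerSeries.coeff_C_mul, PowerSeries.coeff_mk, ← zPow_add,
    PowerSeries.coeff_one]
  rcases m with _ | m
  · rw [PowerSeries.coeff_zero_X_mul, sub_zero, if_pos rfl, ← zPow_zero]
    rfl
  · rw [PowerSeries.coeff_succ_X_mul, PowerSeries.coeff_mk, if_neg (Nat.succ_ne_zero m),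
      sub_eq_zero]
    exact congrArg zPow (by push_cast; ring)

theorem isUnit_serY_sub_serX : IsUnit (serY - serX) :=
  IsUnit.of_mul_eq_one _ serY_sub_serX_mul

theorem inverse_serY_sub_serX :
    Ring.inverse (serY - serX) = PowerSeries.mk (fun m => zPow (-((m : ℤ) + 1))) :=
  left_inv_eq_right_inv (Ring.inverse_mul_cancel _ isUnit_serY_sub_serX) serY_sub_serX_mul

/-- The series of `x/(y - x)` is `∑_{k ≥ 1} x^k y^{-k}`. -/
theorem coeffXY_serX_mul_inverse (k : ℕ) (l : ℤ) :
    coeffXY k l (serX * Ring.inverse (serY - serX)) = if 1 ≤ k ∧ l = -k then 1 else 0 := by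
  rw [inverse_serY_sub_serX]
  change zCoeff l (PowerSeries.coeff k (PowerSeries.X * _)) = _
  rcases k with _ | k
  · rw [PowerSeries.coeff_zero_X_mul, map_zero, if_neg (by omega)]
  · rw [PowerSeries.coeff_succ_X_mul, PowerSeries.coeff_mk, zCoeff_zPow]
    congr 1
    simp

theorem coeffXY_one (k : ℕ) (l : ℤ) : coeffXY k l 1 = if k = 0 ∧ l = 0 then 1 else 0 := by
  change zCoeff l (PowerSeries.coeff k 1) = _
  rw [PowerSeries.coeff_one]
  by_cases hk : k = 0
  · rw [if_pos hk, ← zPow_zero, zCoeff_zPow]; simp [hk]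
  · rw [if_neg hk, map_zero]; simp [hk]

theorem coeffXY_serX (k : ℕ) (l : ℤ) : coeffXY k l serX = if k = 1 ∧ l = 0 then 1 else 0 := by
  change zCoeff l (PowerSeries.coeff k PowerSeries.X) = _
  rw [PowerSeries.coeff_X]
  by_cases hk : k = 1
  · rw [if_pos hk, ← zPow_zero, zCoeff_zPow]; simp [hk]
  · rw [if_neg hk, map_zero]; simp [hk]

theorem coeffXY_serY (k : ℕ) (l : ℤ) : coeffXY k l serY = if k = 0 ∧ l = 1 then 1 else 0 := by
  change zCoeff l (PowerSeries.coeff k (PowerSeries.C (zPow 1))) = _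
  rw [PowerSeries.coeff_C]
  by_cases hk : k = 0
  · rw [if_pos hk, zCoeff_zPow]; simp [hk]
  · rw [if_neg hk, map_zero]; simp [hk]

theorem coeffXYTensor_tmul (k : ℕ) (l : ℤ) (f : SeriesXY) (r : GG n) :
    coeffXYTensor k l (f ⊗ₜ[ℂ] r) = coeffXY k l f • r := by
  simp [coeffXYTensor]

theorem coeffXYTensor_add (k : ℕ) (l : ℤ) (r s : SeriesXY ⊗[ℂ] GG n) :
    coeffXYTensor k l (r + s) = coeffXYTensor k l r + coeffXYTensor k l s := by
  simp [coeffXYTensor]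

theorem coeffXYTensor_rC (k : ℕ) (l : ℤ) :
    coeffXYTensor k l (rC h serX serY) =
      (if 1 ≤ k ∧ l = -k then (1 : ℂ) else 0) • casimir n
      + (if k = 0 ∧ l = 0 then (1 : ℂ) else 0) • rConst h
      + (if k = 1 ∧ l = 0 then (1 : ℂ) else 0) • rCoeffX n c
      + (if k = 0 ∧ l = 1 then (1 : ℂ) else 0) • rCoeffY n c := by
  rw [rC_eq h isUnit_serY_sub_serX, coeffXYTensor_add, coeffXYTensor_add, coeffXYTensor_add,
    coeffXYTensor_tmul, coeffXYTensor_tmul, coeffXYTensor_tmul, coeffXYTensor_tmul,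
    coeffXY_serX_mul_inverse, coeffXY_one, coeffXY_serX, coeffXY_serY]

theorem entrywise_zCoeff_wElt (k : ℕ) (l : ℤ) (a : SL n ℂ) :
    entrywise n (zCoeff l) (wElt h k a).1 =
      contr n a.1 (coeffXYTensor k l (rC h serX serY)) := by
  rw [coeffXYTensor_rC]
  simp only [map_add, map_smul, contr_casimir]
  change _ = _ + _ • opConst h a + _ • opX n c a + _ • opY n c a
  match k with
  | 0 =>
    simp only [wElt, map_add, entrywise_zCoeff_zMul]
    simp
  | 1 =>
    simp only [wElt, map_add, entrywise_zCoeff_zMul]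
    simp
  | k + 2 =>
    simp only [wElt, entrywise_zCoeff_zMul]
    simp

theorem pairing_monomial_wElt (k k' : ℕ) (X a : SL n ℂ) :
    pairing (jMap n (entrywise n (Polynomial.monomial (R := ℂ) k) X)) (wElt h k' a) =
      if k = k' then trForm n X a else 0 := by
  rw [pairing_jMap_monomial]
  match k' with
  | 0 =>
    simp only [wElt, map_add, entrywise_zCoeff_zMul]
    rw [if_neg (show ¬ (-(k : ℤ) = 1) by omega)]
    by_cases hk : k = 0 <;> simp [hk]
  | 1 =>
    simp only [wElt, map_add, entrywise_zCoeff_zMul, neg_inj]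
    by_cases hk : k = 0
    · simp [hk]
    · by_cases hk1 : k = 1 <;> simp [hk, hk1]
  | k' + 2 =>
    simp only [wElt, entrywise_zCoeff_zMul, neg_inj, Nat.cast_inj]
    split_ifs <;> simp

theorem wElt_isDualFamily (hc : c < n) {ι : Type} [Fintype ι] [DecidableEq ι]
    (g : Module.Basis ι ℂ (SL n ℂ)) :
    IsDualFamily (WW n c) g fun k β =>
      wElt h k ((trForm n).dualBasis (trForm_nondegenerate n) g β) := by
  refine ⟨fun k β => wElt_mem h hc k _, fun k β => ?_, fun k β k' β' hne => ?_⟩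
  · rw [gElt, pairing_monomial_wElt, if_pos rfl,
      LinearMap.BilinForm.apply_dualBasis_right _ (trForm_isSymm n), if_pos rfl]
  · rw [gElt, pairing_monomial_wElt]
    split_ifs with hk
    · rw [LinearMap.BilinForm.apply_dualBasis_right _ (trForm_isSymm n), if_neg]
      rintro rfl
      exact hne (by rw [hk])
    · rfl

theorem IsDualFamily.unique (hc : c < n) (h : Nat.Coprime n c) {ι : Type}
    {g : Module.Basis ι ℂ (SL n ℂ)} {w w' : ℕ → ι → DD n} (hw : IsDualFamily (WW n c) g w)
    (hw' : IsDualFamily (WW n c) g w') : w' = w := by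
  funext k β
  rw [← sub_eq_zero]
  set v := w' k β - w k β with hv
  have hpair : ∀ k' β', pairing (gElt g k' β') v = 0 := by
    intro k' β'
    rw [hv, pairing_sub_right]
    by_cases he : (k', β') = (k, β)
    · obtain ⟨rfl, rfl⟩ := Prod.mk.inj he
      rw [hw.2.1, hw'.2.1, sub_self]
    · rw [hw.2.2 _ _ _ _ he, hw'.2.2 _ _ _ _ he, sub_self]
  have hcoef : ∀ k' : ℕ, entrywise n (zCoeff (-k')) v.1 = if k' = 0 then v.2 else 0 := by
    intro k'
    rw [← sub_eq_zero]
    refine eq_zero_of_trForm_left fun a => ?_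
    have hlin : (trForm n).flip (entrywise n (zCoeff (-k')) v.1 - if k' = 0 then v.2 else 0) = 0 :=
      g.ext fun β' => by
        have := hpair k' β'
        rw [gElt, pairing_jMap_monomial] at this
        change trForm n (g β') _ = 0
        rw [map_sub, ← this]
        split_ifs <;> simp
    exact LinearMap.congr_fun hlin a
  refine eq_zero_of_mem_WW h hc (Submodule.sub_mem _ (hw'.1 k β) (hw.1 k β)) (fun l hl => ?_) ?_
  · have := hcoef (-l).toNat
    rw [if_neg (by omega), Int.toNat_of_nonneg (by omega), neg_neg] at this
    exact this
  · have := hcoef 0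
    rwa [if_pos rfl, Nat.cast_zero, neg_zero] at this

end expansion

/-! ### The operator form of the Yang-Baxter equation -/

/-- Partial fractions for the bracket of two functions of `y` with simple poles at `x₁` and `x₂` and
linear polynomial parts. -/
theorem lie_partial_fractions {K L : Type*} [Field K] [LieRing L] [LieAlgebra K L] {x₁ x₂ y : K}
    (h₁₂ : x₁ ≠ x₂) (h₁ : y ≠ x₁) (h₂ : y ≠ x₂) (a b u s v t : L) :
    ⁅(x₁ / (y - x₁)) • a + u + y • s, (x₂ / (y - x₂)) • b + v + y • t⁆ =
      (x₁ / (y - x₁)) • ⁅a, (x₂ / (x₁ - x₂)) • b + v + x₁ • t⁆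
      + (x₂ / (y - x₂)) • ⁅(x₁ / (x₂ - x₁)) • a + u + x₂ • s, b⁆
      + (⁅u, v⁆ + x₁ • ⁅a, t⁆ + x₂ • ⁅s, b⁆) + y • (⁅u, t⁆ + ⁅s, v⁆) + (y * y) • ⁅s, t⁆ := by
  have e1 := sub_ne_zero.2 h₁₂
  have e2 := sub_ne_zero.2 h₁₂.symm
  have e3 := sub_ne_zero.2 h₁
  have e4 := sub_ne_zero.2 h₂
  simp only [lie_add, add_lie, smul_lie, lie_smul]
  match_scalars <;> field_simp <;> ring

section cybe

variable {n c : ℕ} (h : Nat.Coprime n c)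

/-- The operator given by `r_c(x, y)`. -/
def opR (x y : ℂ) (a : SL n ℂ) : SL n ℂ :=
  (x / (y - x)) • a + (opConst h a + x • opX n c a) + y • opY n c a

theorem zMul_zero_lie (X Y : SL n ℂ) : zMul n 0 ⁅X, Y⁆ = ⁅zMul n 0 X, zMul n 0 Y⁆ := by
  have hz : ∀ Z : SL n ℂ, (zMul n 0 Z).1 = Z.1.map (algebraMap ℂ (LaurentSeries ℂ)) := by
    intro Z
    ext1 i j
    change Z.1 i j • zPow 0 = _
    rw [zPow_zero, ← Algebra.algebraMap_eq_smul_one]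
    rfl
  refine Subtype.ext ?_
  change _ = (zMul n 0 X).1 * (zMul n 0 Y).1 - (zMul n 0 Y).1 * (zMul n 0 X).1
  rw [hz, hz, hz, ← Matrix.map_mul, ← Matrix.map_mul]
  change (X.1 * Y.1 - Y.1 * X.1).map _ = _
  rw [Matrix.map_sub _ (map_sub _)]

theorem zMul_eq_smul (m : ℤ) (X : SL n ℂ) : zMul n m X = zPow m • zMul n 0 X := by
  refine sl_ext fun i j => ?_
  change X.1 i j • zPow m = zPow m * (X.1 i j • zPow 0)
  rw [zPow_zero, mul_smul_comm, mul_one]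

theorem zMul_zero_smul (t : ℂ) (X : SL n ℂ) :
    zMul n 0 (t • X) = algebraMap ℂ (LaurentSeries ℂ) t • zMul n 0 X := by
  refine sl_ext fun i j => ?_
  change (t * X.1 i j) • zPow 0 = algebraMap ℂ (LaurentSeries ℂ) t * (X.1 i j • zPow 0)
  rw [← Algebra.smul_def, mul_smul]

/-- The expansion of `x/(z - x)` in powers of `z⁻¹`. -/
def poleSeries (x : ℂ) : LaurentSeries ℂ :=
  algebraMap ℂ (LaurentSeries ℂ) x / (zPow 1 - algebraMap ℂ (LaurentSeries ℂ) x)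

theorem zCoeff_algebraMap (l : ℤ) (x : ℂ) :
    zCoeff l (algebraMap ℂ (LaurentSeries ℂ) x) = if l = 0 then x else 0 := by
  rw [Algebra.algebraMap_eq_smul_one, ← zPow_zero, zCoeff_smul_zPow]

theorem zPow_one_ne (x : ℂ) : zPow 1 ≠ algebraMap ℂ (LaurentSeries ℂ) x := by
  intro he
  have := congrArg (zCoeff 1) he
  rw [zCoeff_zPow, zCoeff_algebraMap] at this
  norm_num at this

/-- `x/(z - x) = x z⁻¹ + O(z⁻²)`. -/
theorem zCoeff_poleSeries_sub (x : ℂ) {l : ℤ} (hl : -2 < l) :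
    zCoeff l (poleSeries x - x • zPow (-1)) = 0 := by
  set g : LaurentSeries ℂ := (zPow 1 - algebraMap ℂ (LaurentSeries ℂ) x)⁻¹ with hg
  have hrec : ∀ l, zCoeff (l - 1) g = x * zCoeff l g + if l = 0 then 1 else 0 := by
    intro l
    have h1 : (zPow 1 - algebraMap ℂ (LaurentSeries ℂ) x) * g = 1 :=
      mul_inv_cancel₀ (sub_ne_zero.2 (zPow_one_ne x))
    have h2 := congrArg (zCoeff l) h1
    rw [sub_mul, map_sub, zCoeff_zPow_mul, ← Algebra.smul_def, map_smul, ← zPow_zero,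
      zCoeff_zPow, smul_eq_mul] at h2
    linear_combination h2
  -- The coefficients of `(z - x)⁻¹` vanish in large degrees, and the recursion carries this down to
  -- degree `0`.
  have hbig : ∀ l, -g.order < l → zCoeff l g = 0 := fun l hl =>
    HahnSeries.coeff_eq_zero_of_lt_order (show -l < g.order by omega)
  have hdown : ∀ m : ℕ, ∀ l, 0 ≤ l → -g.order < l + m → zCoeff l g = 0 := by
    intro m
    induction m with
    | zero => intro l _ h2; exact hbig l (by simpa using h2)
    | succ m ih =>
      intro l h1 h2
      have h3 := hrec (l + 1)
      rw [add_sub_cancel_right, ih (l + 1) (by omega) (by push_cast at h2; omega),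
        if_neg (by omega)] at h3
      simpa using h3
  have hnn : ∀ l, 0 ≤ l → zCoeff l g = 0 := fun l hl =>
    hdown (-g.order + 1).toNat l hl (by omega)
  have hp : poleSeries x = x • g := by
    rw [poleSeries, div_eq_mul_inv, Algebra.smul_def]
  rw [hp, ← smul_sub, map_smul, map_sub, zCoeff_zPow]
  rcases eq_or_ne l (-1) with rfl | h1
  · have h3 := hrec 0
    rw [hnn 0 le_rfl] at h3
    norm_num at h3
    rw [h3]
    simp
  · rw [hnn l (by omega), if_neg h1]
    simp

/-- The sum `∑_k x^k w_k(a)`, whose first component is the expansion of `r_c(x, z)` contracted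
with `a`. -/
def wSum (x : ℂ) (a : SL n ℂ) : DD n :=
  (poleSeries x • zMul n 0 a + zMul n 0 (opConst h a + x • opX n c a)
      + zPow 1 • zMul n 0 (opY n c a),
    opConst h a + x • opX n c a - a)

theorem wSum_mem (hc : c < n) (x : ℂ) (a : SL n ℂ) : wSum h x a ∈ WW n c := by
  have ht : (poleSeries x - x • zPow (-1)) • zMul n 0 a ∈ tail n (-2) := by
    intro i j l hl
    change zCoeff l ((poleSeries x - x • zPow (-1)) * (a.1 i j • zPow 0)) = 0
    rw [zPow_zero, mul_smul_comm, mul_one, map_smul, zCoeff_poleSeries_sub x hl, smul_zero]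
  have hT := tail_prod_le_WW n c (Submodule.mem_prod.2 ⟨ht, Submodule.zero_mem ⊥⟩ :
        ((_, (0 : SL n ℂ)) : DD n) ∈ (tail n (-2)).prod ⊥)
  have hsum := Submodule.add_mem _ (Submodule.add_mem _ (wElt_mem h hc 0 a)
    (Submodule.smul_mem _ x (wElt_mem h hc 1 a))) hT
  convert hsum using 1
  have hx : x • zMul n (-1) a = (x • zPow (-1)) • zMul n 0 a := by
    rw [zMul_eq_smul]
    refine sl_ext fun i j => ?_
    exact (smul_mul_assoc x (zPow (-1)) ((zMul n 0 a).1 i j)).symm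
  refine Prod.ext ?_ ?_
  · rw [Prod.fst_add, Prod.fst_add, Prod.smul_fst]
    simp only [wElt, wSum]
    rw [smul_add, hx, sub_smul, map_add, map_smul, zMul_eq_smul 1]
    abel
  · simp only [Prod.snd_add, Prod.smul_snd, wElt, wSum]
    abel

/-- The Yang-Baxter equation for the operators `opR`. Both sides are functions of `x₃` with simple
poles at `x₁` and `x₂`, and the poles agree by partial fractions. The difference is polynomial and
comes from an element of `𝔓 ∩ 𝔚_(c,d) = 0`. -/
theorem lie_opR (hc : c < n) {x₁ x₂ x₃ : ℂ} (h₁₂ : x₁ ≠ x₂) (h₁₃ : x₁ ≠ x₃) (h₂₃ : x₂ ≠ x₃)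
    (a b : SL n ℂ) :
    ⁅opR h x₁ x₃ a, opR h x₂ x₃ b⁆ =
      opR h x₁ x₃ ⁅a, opR h x₂ x₁ b⁆ + opR h x₂ x₃ ⁅opR h x₁ x₂ a, b⁆ := by
  set u := opConst h a + x₁ • opX n c a with hu
  set v := opConst h b + x₂ • opX n c b with hv
  set s := opY n c a with hs
  set t := opY n c b with ht
  set a' := ⁅a, opR h x₂ x₁ b⁆ with ha'
  set b' := ⁅opR h x₁ x₂ a, b⁆ with hb'
  have ha'2 : a' = ⁅a, (x₂ / (x₁ - x₂)) • b + v + x₁ • t⁆ := rfl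
  have hb'2 : b' = ⁅(x₁ / (x₂ - x₁)) • a + u + x₂ • s, b⁆ := rfl
  set M₀ := ⁅u, v⁆ + x₁ • ⁅a, t⁆ + x₂ • ⁅s, b⁆ - (opConst h a' + x₁ • opX n c a')
    - (opConst h b' + x₂ • opX n c b') with hM₀
  set M₁ := ⁅u, t⁆ + ⁅s, v⁆ - opY n c a' - opY n c b' with hM₁
  set M₂ := ⁅s, t⁆ with hM₂
  -- At `x₃ = z` the poles cancel in `[R₁₃ a, R₂₃ b] - R₁₃ a' - R₂₃ b'`, which leaves
  -- `M₀ + z M₁ + z² M₂`. The second component is `M₀` as well, so the element lies in `𝔓`.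
  have hmem : ⁅wSum h x₁ a, wSum h x₂ b⁆ - wSum h x₁ a' - wSum h x₂ b' ∈ WW n c :=
    Submodule.sub_mem _ (Submodule.sub_mem _ (WW_lie_mem (wSum_mem h hc _ _) (wSum_mem h hc _ _))
      (wSum_mem h hc _ _)) (wSum_mem h hc _ _)
  have hval : ⁅wSum h x₁ a, wSum h x₂ b⁆ - wSum h x₁ a' - wSum h x₂ b' =
      (zMul n 0 M₀ + zMul n 1 M₁ + zMul n 2 M₂, M₀) := by
    refine Prod.ext ?_ ?_
    · change ⁅(wSum h x₁ a).1, (wSum h x₂ b).1⁆ - (wSum h x₁ a').1 - (wSum h x₂ b').1 = _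
      have hL := lie_partial_fractions (K := LaurentSeries ℂ) (L := SL n (LaurentSeries ℂ))
        (fun e => h₁₂ ((algebraMap ℂ (LaurentSeries ℂ)).injective e)) (zPow_one_ne x₁)
        (zPow_one_ne x₂) (zMul n 0 a) (zMul n 0 b) (zMul n 0 u) (zMul n 0 s) (zMul n 0 v)
        (zMul n 0 t)
      simp only [← map_sub, ← map_div₀, ← zMul_zero_smul, ← map_add, ← zMul_zero_lie] at hL
      rw [← ha'2, ← hb'2] at hL
      simp only [wSum]
      refine (congrArg (· - _ - _) hL).trans ?_
      rw [zMul_eq_smul 1 M₁, zMul_eq_smul 2 M₂, show (2 : ℤ) = 1 + 1 from rfl, zPow_add, hM₀, hM₁]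
      simp only [map_sub, map_add, smul_sub, smul_add, poleSeries]
      abel
    · change ⁅u - a, v - b⁆ - (opConst h a' + x₁ • opX n c a' - a')
        - (opConst h b' + x₂ • opX n c b' - b') = M₀
      have hab : ⁅u - a, v - b⁆ + a' + b' = ⁅u, v⁆ + x₁ • ⁅a, t⁆ + x₂ • ⁅s, b⁆ := by
        have e1 := sub_ne_zero.2 h₁₂
        have e2 := sub_ne_zero.2 h₁₂.symm
        rw [ha'2, hb'2]
        simp only [lie_add, add_lie, smul_lie, lie_smul, sub_lie, lie_sub]
        match_scalars <;> field_simp <;> ring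
      rw [hM₀, ← hab]
      abel
  have hco : ∀ l, entrywise n (zCoeff l) (zMul n 0 M₀ + zMul n 1 M₁ + zMul n 2 M₂) =
      (if l = 0 then M₀ else 0) + (if l = 1 then M₁ else 0) + if l = 2 then M₂ else 0 := by
    intro l
    rw [map_add, map_add, entrywise_zCoeff_zMul, entrywise_zCoeff_zMul, entrywise_zCoeff_zMul]
  rw [hval] at hmem
  have hzero := eq_zero_of_mem_WW h hc hmem
    (fun l hl => by
      rw [hco, if_neg (by omega), if_neg (by omega), if_neg (by omega), add_zero, add_zero])
    (by rw [hco]; norm_num)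
  have hM : ∀ l : ℤ, (if l = 0 then M₀ else 0) + (if l = 1 then M₁ else 0)
      + (if l = 2 then M₂ else 0) = 0 := by
    intro l
    rw [← hco, (Prod.mk.inj hzero).1, map_zero]
  have h0 : M₀ = 0 := by simpa using hM 0
  have h1 : M₁ = 0 := by simpa using hM 1
  have h2 : M₂ = 0 := by simpa using hM 2
  -- The same partial fractions, now at the complex number `x₃`.
  have hC := lie_partial_fractions h₁₂ h₁₃.symm h₂₃.symm a b u s v t
  rw [← ha'2, ← hb'2, ← hM₂, h2] at hC
  refine hC.trans ?_
  rw [hM₀, sub_sub, sub_eq_zero] at h0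
  rw [hM₁, sub_sub, sub_eq_zero] at h1
  rw [h0, h1, opR, opR]
  module

end cybe

/-! ### The Yang-Baxter equation in `𝔤𝔩ₙ ⊗ 𝔤𝔩ₙ ⊗ 𝔤𝔩ₙ` -/

section tensors

variable {n : ℕ}

attribute [local instance] LieRing.ofAssociativeRing

/-- Contraction of the first tensor factor with a matrix, `X ⊗ m ↦ tr (X A) m`. -/
def contrMat (A : Mat n) (M : Type) [AddCommGroup M] [Module ℂ M] : Mat n ⊗[ℂ] M →ₗ[ℂ] M :=
  TensorProduct.lift
    ((LinearMap.lsmul ℂ M).comp (Matrix.traceLinearMap (Fin n) ℂ ℂ ∘ₗ LinearMap.mulRight ℂ A))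

theorem contrMat_tmul (A : Mat n) {M : Type} [AddCommGroup M] [Module ℂ M] (X : Mat n) (m : M) :
    contrMat A M (X ⊗ₜ[ℂ] m) = (X * A).trace • m := by
  simp [contrMat]

/-- The contractions separate the elements of the tensor product. -/
theorem eq_zero_of_contrMat {M : Type} [AddCommGroup M] [Module ℂ M] {Z : Mat n ⊗[ℂ] M}
    (hZ : ∀ A, contrMat A M Z = 0) : Z = 0 := by
  have key : ∑ i, ∑ j, Matrix.single i j (1 : ℂ) ⊗ₜ[ℂ] contrMat (Matrix.single j i 1) M Z = Z := by
    clear hZ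
    induction Z using TensorProduct.induction_on with
    | zero => simp
    | add Z Z' h h' =>
      simp only [map_add, TensorProduct.tmul_add, Finset.sum_add_distrib]
      rw [h, h']
    | tmul X m =>
      simp only [contrMat_tmul, Matrix.trace_mul_single, TensorProduct.tmul_smul,
        TensorProduct.smul_tmul', ← TensorProduct.sum_tmul]
      congr 1
      conv_rhs => rw [Matrix.matrix_eq_sum_single X]
      simp
  rw [← key]
  simp [hZ]

/-- Contraction of the second tensor factor. -/
def contrSnd (B : Mat n) (r : GG n) : SL n ℂ := contr n B (TensorProduct.comm ℂ _ _ r)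

theorem contrSnd_tmul (B : Mat n) (X Y : SL n ℂ) :
    contrSnd B (X ⊗ₜ[ℂ] Y) = (Y.1 * B).trace • X := by
  rw [contrSnd, TensorProduct.comm_tmul, contr_tmul]

theorem contrSnd_add (B : Mat n) (r s : GG n) :
    contrSnd B (r + s) = contrSnd B r + contrSnd B s := by
  rw [contrSnd, map_add, map_add]; rfl

theorem i12_tmul (X Y : SL n ℂ) : i12 n (X ⊗ₜ[ℂ] Y) = X.1 ⊗ₜ[ℂ] (Y.1 ⊗ₜ[ℂ] 1) := rfl

theorem i13_tmul (X Y : SL n ℂ) : i13 n (X ⊗ₜ[ℂ] Y) = X.1 ⊗ₜ[ℂ] (1 ⊗ₜ[ℂ] Y.1) := rfl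

theorem i23_tmul (X Y : SL n ℂ) : i23 n (X ⊗ₜ[ℂ] Y) = 1 ⊗ₜ[ℂ] (X.1 ⊗ₜ[ℂ] Y.1) := rfl

/-- Contraction of the first two of three tensor factors. -/
def contrTwo (A B : Mat n) : Mat n ⊗[ℂ] (Mat n ⊗[ℂ] Mat n) →ₗ[ℂ] Mat n :=
  contrMat B (Mat n) ∘ₗ contrMat A (Mat n ⊗[ℂ] Mat n)

theorem contrTwo_tmul (A B X Y Z : Mat n) :
    contrTwo A B (X ⊗ₜ[ℂ] (Y ⊗ₜ[ℂ] Z)) = (X * A).trace • (Y * B).trace • Z := by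
  rw [contrTwo, LinearMap.comp_apply, contrMat_tmul, map_smul, contrMat_tmul]

/-- Invariance of the trace form. -/
theorem trace_lie_mul (A X Y : Mat n) :
    (Y * ⁅A, X⁆).trace = (X * Y * A).trace - (Y * X * A).trace := by
  rw [Ring.lie_def, mul_sub, Matrix.trace_sub, ← mul_assoc, ← mul_assoc,
    Matrix.trace_mul_comm (Y * A) X, mul_assoc X Y A]

theorem contrTwo_lie_i12_i13 (A B : Mat n) (r s : GG n) :
    contrTwo A B ⁅i12 n r, i13 n s⁆ = (contr n ⁅A, (contrSnd B r).1⁆ s).1 := by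
  induction r using TensorProduct.induction_on with
  | zero => simp [contrSnd]
  | add r r' h h' =>
    rw [map_add, add_lie, map_add, h, h', contrSnd_add]
    change _ = (contr n ⁅A, (contrSnd B r).1 + (contrSnd B r').1⁆ s).1
    rw [lie_add, map_add]
    rfl
  | tmul X Y =>
    induction s using TensorProduct.induction_on with
    | zero => simp
    | add s s' h h' =>
      rw [map_add, lie_add, map_add, h, h', map_add]
      rfl
    | tmul X' Y' =>
      rw [i12_tmul, i13_tmul, Ring.lie_def, contrSnd_tmul, contr_tmul]
      simp only [Algebra.TensorProduct.tmul_mul_tmul, mul_one, one_mul]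
      rw [map_sub, contrTwo_tmul, contrTwo_tmul, ← sub_smul, ← trace_lie_mul]
      change _ = (X'.1 * ⁅A, (Y.1 * B).trace • X.1⁆).trace • Y'.1
      rw [lie_smul, mul_smul_comm, Matrix.trace_smul, smul_smul, smul_eq_mul, mul_comm]

theorem contrTwo_lie_i12_i23 (A B : Mat n) (r s : GG n) :
    contrTwo A B ⁅i12 n r, i23 n s⁆ = (contr n ⁅B, (contr n A r).1⁆ s).1 := by
  induction r using TensorProduct.induction_on with
  | zero => simp
  | add r r' h h' =>
    rw [map_add, add_lie, map_add, h, h', map_add (contr n A)]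
    change _ = (contr n ⁅B, (contr n A r).1 + (contr n A r').1⁆ s).1
    rw [lie_add, map_add]
    rfl
  | tmul X Y =>
    induction s using TensorProduct.induction_on with
    | zero => simp
    | add s s' h h' =>
      rw [map_add, lie_add, map_add, h, h', map_add]
      rfl
    | tmul X' Y' =>
      rw [i12_tmul, i23_tmul, Ring.lie_def, contr_tmul, contr_tmul]
      simp only [Algebra.TensorProduct.tmul_mul_tmul, mul_one, one_mul]
      rw [map_sub, contrTwo_tmul, contrTwo_tmul, ← smul_sub, ← sub_smul, ← trace_lie_mul]
      change _ = (X'.1 * ⁅B, (X.1 * A).trace • Y.1⁆).trace • Y'.1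
      rw [lie_smul, mul_smul_comm, Matrix.trace_smul, smul_smul, smul_eq_mul]

theorem contrTwo_lie_i13_i23 (A B : Mat n) (r s : GG n) :
    contrTwo A B ⁅i13 n r, i23 n s⁆ = ⁅(contr n A r).1, (contr n B s).1⁆ := by
  induction r using TensorProduct.induction_on with
  | zero => simp
  | add r r' h h' =>
    rw [map_add, add_lie, map_add, h, h', map_add]
    exact (add_lie _ _ _).symm
  | tmul X Y =>
    induction s using TensorProduct.induction_on with
    | zero => simp
    | add s s' h h' =>
      rw [map_add, lie_add, map_add, h, h', map_add]
      exact (lie_add _ _ _).symm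
    | tmul X' Y' =>
      rw [i13_tmul, i23_tmul, Ring.lie_def, contr_tmul, contr_tmul]
      simp only [Algebra.TensorProduct.tmul_mul_tmul, mul_one, one_mul]
      rw [map_sub, contrTwo_tmul, contrTwo_tmul, ← smul_sub, ← smul_sub]
      change _ = ⁅(X.1 * A).trace • Y.1, (X'.1 * B).trace • Y'.1⁆
      rw [lie_smul, smul_lie, smul_comm, Ring.lie_def]

theorem trForm_contrSnd (a b : SL n ℂ) (r : GG n) :
    trForm n a (contrSnd b.1 r) = trForm n (contr n a.1 r) b := by
  induction r using TensorProduct.induction_on with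
  | zero => simp [contrSnd]
  | add r s h h' => rw [contrSnd_add, map_add, map_add, map_add, LinearMap.add_apply, h, h']
  | tmul X Y =>
    rw [contrSnd_tmul, contr_tmul, map_smul, map_smul, LinearMap.smul_apply, trForm_apply,
      trForm_apply, Matrix.trace_mul_comm a.1, smul_eq_mul, smul_eq_mul, mul_comm]

/-- Every matrix agrees with a trace zero matrix up to a scalar matrix, which commutes with
everything and is orthogonal to `𝔤`. -/
theorem exists_sl_sub_scalar (hn : 0 < n) (A : Mat n) :
    ∃ a : SL n ℂ, (∀ X : Mat n, ⁅A, X⁆ = ⁅a.1, X⁆) ∧ contr n A = contr n a.1 := by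
  have hn' : (n : ℂ) ≠ 0 := Nat.cast_ne_zero.2 hn.ne'
  refine ⟨⟨A - (A.trace / n) • (1 : Mat n), mem_sl.2 ?_⟩, fun X => ?_, ?_⟩
  · rw [Matrix.trace_sub, Matrix.trace_smul, Matrix.trace_one, Fintype.card_fin, smul_eq_mul,
      div_mul_cancel₀ _ hn', sub_self]
  · rw [sub_lie, smul_lie, Ring.lie_def 1 X, one_mul, mul_one, sub_self, smul_zero, sub_zero]
  · rw [map_sub, map_smul]
    have h1 : contr n (1 : Mat n) = 0 := by
      refine TensorProduct.ext' fun X Y => ?_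
      rw [contr_tmul, mul_one, trace_val, zero_smul]
      rfl
    rw [h1, smul_zero, sub_zero]

end tensors

section solution

variable {n c : ℕ} (h : Nat.Coprime n c)

theorem rCFun_eq {x y : ℂ} (hxy : x ≠ y) :
    rCFun h x y = (x / (y - x)) • casimir n + rConst h + x • rCoeffX n c + y • rCoeffY n c := by
  rw [rCFun, rC_eq h (sub_ne_zero.2 hxy.symm).isUnit, Ring.inverse_eq_inv', ← div_eq_mul_inv]
  simp only [map_add, TensorProduct.lid_tmul, one_smul]

theorem contr_rCFun {x y : ℂ} (hxy : x ≠ y) (a : SL n ℂ) :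
    contr n a.1 (rCFun h x y) = opR h x y a := by
  rw [rCFun_eq h hxy]
  simp only [map_add, map_smul, contr_casimir, opR]
  change _ • a + opConst h a + x • opX n c a + y • opY n c a = _
  rw [add_assoc ((x / (y - x)) • a)]

/-- Skew-symmetry: `r_c(x, y) = -r_c²¹(y, x)`. -/
theorem contrSnd_rCFun (hc : c < n) {x y : ℂ} (hxy : x ≠ y) (b : SL n ℂ) :
    contrSnd b.1 (rCFun h x y) = -opR h y x b := by
  rw [← sub_eq_zero]
  refine eq_zero_of_trForm_left fun a => ?_
  rw [map_sub, trForm_contrSnd, contr_rCFun h hxy, opR, opR]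
  simp only [map_add, map_smul, map_neg, LinearMap.add_apply, LinearMap.smul_apply, smul_eq_mul]
  have h1 := trForm_opConst_add h hc a b
  have h2 := trForm_opY_add h hc a b
  have h3 := trForm_opY_add h hc b a
  rw [(trForm_isSymm n).eq (opY n c b) a, (trForm_isSymm n).eq b (opX n c a)] at h3
  have e1 := sub_ne_zero.2 hxy
  have e2 := sub_ne_zero.2 hxy.symm
  have h4 : x / (y - x) + y / (x - y) = -1 := by
    field_simp
    ring
  linear_combination h1 + y * h2 + x * h3 + trForm n a b * h4

theorem isCYBESolution_rCFun (hc : c < n) : IsCYBESolution (rCFun h) := by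
  intro x₁ x₂ x₃ h₁₂ h₁₃ h₂₃
  refine eq_zero_of_contrMat fun A => eq_zero_of_contrMat fun B => ?_
  change contrTwo A B _ = 0
  obtain ⟨a, ha1, ha2⟩ := exists_sl_sub_scalar (by omega) A
  obtain ⟨b, hb1, hb2⟩ := exists_sl_sub_scalar (by omega) B
  have hb3 : contrSnd B (rCFun h x₁ x₂) = contrSnd b.1 (rCFun h x₁ x₂) := by
    rw [contrSnd, contrSnd, hb2]
  rw [map_add, map_add, contrTwo_lie_i12_i13, contrTwo_lie_i13_i23, contrTwo_lie_i12_i23, ha1, hb1,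
    ha2, hb2, hb3, contrSnd_rCFun h hc h₁₂, contr_rCFun h h₁₂, contr_rCFun h h₁₃,
    contr_rCFun h h₂₃]
  change (contr n (⁅a, -opR h x₂ x₁ b⁆ : SL n ℂ).1 (rCFun h x₁ x₃)
    + ⁅opR h x₁ x₃ a, opR h x₂ x₃ b⁆
    + contr n (⁅b, opR h x₁ x₂ a⁆ : SL n ℂ).1 (rCFun h x₂ x₃)).1 = 0
  rw [lie_opR h hc h₁₂ h₁₃ h₂₃, ← contr_rCFun h h₁₃ ⁅a, opR h x₂ x₁ b⁆,
    ← contr_rCFun h h₂₃ ⁅opR h x₁ x₂ a, b⁆, lie_neg, ← lie_skew (opR h x₁ x₂ a) b]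
  change (contr n (-(⁅a, opR h x₂ x₁ b⁆ : SL n ℂ).1) (rCFun h x₁ x₃) + _
    + contr n (⁅b, opR h x₁ x₂ a⁆ : SL n ℂ).1 (rCFun h x₂ x₃)).1 = 0
  have hneg : contr n (-⁅b, opR h x₁ x₂ a⁆ : SL n ℂ).1 (rCFun h x₂ x₃) =
      -contr n (⁅b, opR h x₁ x₂ a⁆ : SL n ℂ).1 (rCFun h x₂ x₃) := by
    change contr n (-(⁅b, opR h x₁ x₂ a⁆ : SL n ℂ).1) (rCFun h x₂ x₃) = _
    rw [map_neg]
    rfl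
  rw [hneg, map_neg, LinearMap.neg_apply, neg_add_cancel_left, neg_add_cancel]
  rfl

theorem isQuasiTrigonometricSolution_rCFun (hc : c < n) :
    IsQuasiTrigonometricSolution (rCFun h) := by
  refine ⟨⟨1 ⊗ₜ[ℂ] rConst h + MvPolynomial.X 0 ⊗ₜ[ℂ] rCoeffX n c
    + MvPolynomial.X 1 ⊗ₜ[ℂ] rCoeffY n c, fun x y hxy => ?_⟩, isCYBESolution_rCFun h hc⟩
  rw [rCFun_eq h hxy, evalPoly]
  simp [add_assoc]

end solution

end

end QuasiTrig

theorem theorem5 (n c d : ℕ) (hc : 0 < c) (hd : 0 < d) (hn : c + d = n)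
    (hcop : Nat.Coprime n c) :
    QuasiTrig.IsLagrangianOrder (QuasiTrig.WW n c) ∧
    (∀ (ι : Type) [Fintype ι] (g : Module.Basis ι ℂ (QuasiTrig.SL n ℂ)),
      ∃ w : ℕ → ι → QuasiTrig.DD n,
        QuasiTrig.IsDualFamily (QuasiTrig.WW n c) g w ∧
        (∀ w' : ℕ → ι → QuasiTrig.DD n,
          QuasiTrig.IsDualFamily (QuasiTrig.WW n c) g w' → w' = w) ∧
        ∀ (k : ℕ) (l : ℤ),
          QuasiTrig.seriesCoeff g w k l =
            QuasiTrig.coeffXYTensor k l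
              (QuasiTrig.rC hcop QuasiTrig.serX QuasiTrig.serY)) ∧
    QuasiTrig.IsQuasiTrigonometricSolution (QuasiTrig.rCFun hcop) := by
  have hcn : c < n := by omega
  refine ⟨QuasiTrig.isLagrangianOrder_WW hcn hcop, fun ι _ g => ?_,
    QuasiTrig.isQuasiTrigonometricSolution_rCFun hcop hcn⟩
  classical
  have hdual := QuasiTrig.wElt_isDualFamily hcop hcn g
  refine ⟨_, hdual, fun w' hw' => hdual.unique hcn hcop hw', fun k l => ?_⟩
  rw [QuasiTrig.seriesCoeff]
  simp only [QuasiTrig.entrywise_zCoeff_wElt]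
  exact QuasiTrig.sum_tmul_contr_dualBasis g _
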